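/- **Setting.** Consider a two-player zero-sum partially observable Markov game with horizon $H\ge 1$, finite state layers $\mathcal S_1,\dots,\mathcal S_H$, finite action sets $\mathcal A,\mathcal B$ with $A=|\mathcal A|\ge 1$, finite infoset layers $\mathcal X_h$ (max-player, $X=\sum_h|\mathcal X_h|$) and $\mathcal Y_h$ (min-player), emission maps $s_h\mapsto x(s_h)\in\mathcal X_h$ and $s_h\mapsto y(s_h)\in\mathcal Y_h$ (every infoset being nonempty), initial distribution $p_0$, transition probabilities $p_h(s_{h+1}\mid s_h,a_h,b_h)$, and random rewards in $[0,1]$ with means $\bar r_h(s_h,a_h,b_h)$. Assume that the game has tree structure (each state $s_h$ has a unique history $(s_1,a_1,b_1,\dots,s_{h-1},a_{h-1},b_{h-1})$ leading to it) and that both players have perfect recall (each infoset $x_h$ has a unique history $(x_1,a_1,\dots,x_{h-1},a_{h-1})$ leading to it, and likewise each $y_h$). A policy $\mu\in\Pi_{\max}$ assigns a distribution $\mu_h(\cdot\mid x_h)$ on $\mathcal A$ to each infoset, and $\mu_{1:h}(x_h,a_h)=\prod_{h'\le h}\mu_{h'}(a_{h'}\mid x_{h'})$ along the unique history of $x_h$;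 the same for the min-player's policies $\nu$; and $p_{1:h}(s_h)=p_0(s_1)\prod_{h'<h}p_{h'}(s_{h'+1}\mid s_{h'},a_{h'},b_{h'})$ along the unique history of $s_h$. For an opponent policy $\nu^t$ put $$\ell^t_h(x_h,a_h)=\sum_{s_h\in x_h,\ b_h\in\mathcal B}p_{1:h}(s_h)\,\nu^t_{1:h}(y(s_h),b_h)\,\bigl(1-\bar r_h(s_h,a_h,b_h)\bigr),\qquad \langle\mu,\ell^t\rangle=\sum_{h=1}^H\sum_{x_h,a_h}\mu_{1:h}(x_h,a_h)\,\ell^t_h(x_h,a_h).$$ Let $\mathcal C_h(x_{h'},a_{h'})\subset\mathcal X_h$ be the set of infosets of layer $h$ reachable from $(x_{h'},a_{h'})$, and $\mathcal C_h(x_{h'})=\bigcup_{a}\mathcal C_h(x_{h'},a)$. The balanced exploration policy $\mu^{\star,h}$ for layer $h$ is $\mu^{\star,h}_{h'}(a\mid x_{h'})=|\mathcal C_h(x_{h'},a)|/|\mathcal C_h(x_{h'})|$ for $h'<h$ and $\mu^{\star,h}_{h'}(a\mid x_{h'})=1/A$ for $h'\ge h$. **Algorithm (Balanced CFR with Hedge,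 parameter $\eta$).** Start with $\mu^1_h(a\mid x_h)=1/A$. In each round $t=1,\dots,T$, before which the (adaptive, possibly adversarial) opponent fixes a policy $\nu^t$ depending only on past information, play for each $h=1,\dots,H$ one episode with $\mu^{t,(h)}=(\mu^{\star,h}_{1:h}\,\mu^t_{h+1:H})$ (the balanced policy at steps $1,\dots,h$, then $\mu^t$) against $\nu^t$, observe the max-player's infosets, actions and rewards $(x^{t,(h)}_{k},a^{t,(h)}_{k},r^{t,(h)}_{k})_{k\le H}$, and form $$\tilde L^t_h(x_h,a_h)=\frac{\mathbf 1\{(x^{t,(h)}_h,a^{t,(h)}_h)=(x_h,a_h)\}}{\mu^{\star,h}_{1:h}(x_h,a_h)}\Bigl(H-h+1-\sum_{h'=h}^H r^{t,(h)}_{h'}\Bigr).$$ Then update every infoset by Hedge with learning rate $\eta\mu^{\star,h}_{1:h}(x_h,a)$ (which does not depend on $a$): $$\mu^{t+1}_h(a\mid x_h)\propto_a\mu^t_h(a\mid x_h)\,\exp\bigl(-\eta\,\mu^{\star,h}_{1:h}(x_h,a)\,\tilde L^t_h(x_h,a)\bigr).$$ **Theorem.** There is an absolute constant $C>0$ such that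 for every such game, every $T\ge 1$, every $\delta\in(0,1)$ and every such opponent, if Balanced CFR with Hedge is run with $\eta=\sqrt{XA\iota/(H^3T)}$, where $\iota=\log(10XA/\delta)$, then with probability at least $1-\delta$ the maintained policies $\mu^t$ satisfy $$\max_{\mu^\dagger\in\Pi_{\max}}\ \sum_{t=1}^T\langle\mu^t-\mu^\dagger,\ell^t\rangle\ \le\ C\sqrt{H^3XAT\iota}.$$ -/

import Mathlib

open MeasureTheory ProbabilityTheory
open scoped BigOperators unitInterval

noncomputable section

/-- A finite-horizon tabular two-player zero-sum partially observable Markov game with horizon `H`.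
The layers are numbered `0, …, H - 1`, so layer `h` here is step `h + 1` in the usual one-based
counting; `S h`, `X h`, `Y h` are the states, the infosets of the max-player and the infosets of the
min-player of layer `h`. Only the layers `h < H` (and the transitions with `h + 1 < H`) are ever
used. The reward at `(s, a, b)` is random with a law on `[0, 1]`. -/
structure POMG (H : ℕ) (S X Y : ℕ → Type*) (A B : Type*) [∀ h, Fintype (S h)] where
  /-- the horizon is positive -/
  H_pos : 0 < H
  /-- emission function of the max-player -/
  infoX : ∀ h, S h → X h
  /-- emission function of the min-player -/
  infoY : ∀ h, S h → Y h
  /-- initial distribution -/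
  init : S 0 → ℝ
  init_mem : init ∈ stdSimplex ℝ (S 0)
  /-- transition probabilities: `trans h s a b s'` is the probability of moving from `s` in layer
  `h` to `s'` in layer `h + 1` under the actions `a`, `b` -/
  trans : ∀ h, S h → A → B → S (h + 1) → ℝ
  trans_mem : ∀ h, h + 1 < H → ∀ s a b, trans h s a b ∈ stdSimplex ℝ (S (h + 1))
  /-- law of the random reward -/
  reward : ∀ h, S h → A → B → ProbabilityMeasure I

namespace POMG

variable {H : ℕ} {S X Y : ℕ → Type*} {A B : Type*} [∀ h, Fintype (S h)]

/-- The mean reward. -/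
def meanReward (G : POMG H S X Y A B) (h : ℕ) (s : S h) (a : A) (b : B) : ℝ :=
  ∫ r : I, (r : ℝ) ∂(G.reward h s a b : Measure I)

/-- The infoset `x'` of the max-player can follow immediately after `(x, a)`. -/
def StepX (G : POMG H S X Y A B) {h : ℕ} (x : X h) (a : A) (x' : X (h + 1)) : Prop :=
  ∃ (s : S h) (b : B) (s' : S (h + 1)),
    G.infoX h s = x ∧ G.infoX (h + 1) s' = x' ∧ 0 < G.trans h s a b s'

/-- The infoset `y'` of the min-player can follow immediately after `(y, b)`. -/
def StepY (G : POMG H S X Y A B) {h : ℕ} (y : Y h) (b : B) (y' : Y (h + 1)) : Prop :=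
  ∃ (s : S h) (a : A) (s' : S (h + 1)),
    G.infoY h s = y ∧ G.infoY (h + 1) s' = y' ∧ 0 < G.trans h s a b s'

/-- `G.ReachX x a x'`: the infoset `x'` (of a strictly later layer) is reachable from `(x, a)`. -/
inductive ReachX (G : POMG H S X Y A B) {h : ℕ} (x : X h) (a : A) : ∀ {h' : ℕ}, X h' → Prop
  | child {x' : X (h + 1)} : G.StepX x a x' → ReachX G x a x'
  | step {k : ℕ} {x' : X k} {a' : A} {x'' : X (k + 1)} :
      ReachX G x a x' → G.StepX x' a' x'' → ReachX G x a x''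

end POMG

/-- An imperfect-information extensive-form game: a POMG with tree structure in which both players
have perfect recall. -/
structure IIEFG (H : ℕ) (S X Y : ℕ → Type*) (A B : Type*) [∀ h, Fintype (S h)] extends
    POMG H S X Y A B where
  /-- infosets are nonempty sets of states -/
  infoX_surj : ∀ h, h < H → Function.Surjective (infoX h)
  infoY_surj : ∀ h, h < H → Function.Surjective (infoY h)
  /-- tree structure: each state is entered from exactly one state and pair of actions -/
  tree : ∀ h, h + 1 < H → ∀ s' : S (h + 1),
    ∃! q : S h × A × B, 0 < trans h q.1 q.2.1 q.2.2 s'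
  /-- perfect recall of the max-player -/
  recallX : ∀ h, h + 1 < H → ∀ x' : X (h + 1), ∃! q : X h × A, toPOMG.StepX q.1 q.2 x'
  /-- perfect recall of the min-player -/
  recallY : ∀ h, h + 1 < H → ∀ y' : Y (h + 1), ∃! q : Y h × B, toPOMG.StepY q.1 q.2 y'

/-- Conditional-form strategies: for an infoset family `Z` and an action set `C`, the number
`μ h z c` is the probability of the action `c` at the infoset `z` of layer `h`. -/
abbrev Strategy (H : ℕ) (Z : ℕ → Type*) (C : Type*) : Type _ := ∀ h : Fin H, Z h → C → ℝ

/-- The set of policies (`Π_max` for `Z = X`, `C = A`; `Π_min` for `Z = Y`, `C = B`): the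
strategies which are probability distributions over actions at every infoset. -/
def policies (H : ℕ) (Z : ℕ → Type*) (C : Type*) [Fintype C] : Set (Strategy H Z C) :=
  {μ | ∀ (h : Fin H) (z : Z h), μ h z ∈ stdSimplex ℝ C}

/-- The states and actions `(s_h, a_h, b_h)` of one episode. -/
abbrev GamePath (H : ℕ) (S : ℕ → Type*) (A B : Type*) : Type _ := ∀ h : Fin H, S h × A × B

/-- What the max-player observes in one episode: her infosets, actions and rewards. -/
abbrev Observation (H : ℕ) (X : ℕ → Type*) (A : Type*) : Type _ := ∀ h : Fin H, X h × A × I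

namespace IIEFG

variable {H : ℕ} {S X Y : ℕ → Type*} {A B : Type*} [∀ h, Fintype (S h)]

/-- The unique predecessor `(s, a, b)` of a state. -/
def parentS (G : IIEFG H S X Y A B) (h : ℕ) (hh : h + 1 < H) (s' : S (h + 1)) : S h × A × B :=
  (G.tree h hh s').choose

/-- The unique predecessor `(x, a)` of an infoset of the max-player. -/
def parentX (G : IIEFG H S X Y A B) (h : ℕ) (hh : h + 1 < H) (x' : X (h + 1)) : X h × A :=
  (G.recallX h hh x').choose

/-- The unique predecessor `(y, b)` of an infoset of the min-player. -/
def parentY (G : IIEFG H S X Y A B) (h : ℕ) (hh : h + 1 < H) (y' : Y (h + 1)) : Y h × B :=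
  (G.recallY h hh y').choose

/-- Sequence-form transition probability `p_{1:h}(s_h)`. -/
def transSeq (G : IIEFG H S X Y A B) : ∀ h : ℕ, h < H → S h → ℝ
  | 0, _, s => G.init s
  | h + 1, hh, s =>
      G.transSeq h (Nat.lt_of_succ_lt hh) (G.parentS h hh s).1 *
        G.trans h (G.parentS h hh s).1 (G.parentS h hh s).2.1 (G.parentS h hh s).2.2 s

/-- Sequence form `μ_{1:h}(x_h, a_h)` of a strategy of the max-player. -/
def seqX (G : IIEFG H S X Y A B) (μ : Strategy H X A) : ∀ h : ℕ, h < H → X h → A → ℝ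
  | 0, hh, x, a => μ ⟨0, hh⟩ x a
  | h + 1, hh, x, a =>
      G.seqX μ h (Nat.lt_of_succ_lt hh) (G.parentX h hh x).1 (G.parentX h hh x).2 *
        μ ⟨h + 1, hh⟩ x a

/-- Sequence form `ν_{1:h}(y_h, b_h)` of a strategy of the min-player. -/
def seqY (G : IIEFG H S X Y A B) (ν : Strategy H Y B) : ∀ h : ℕ, h < H → Y h → B → ℝ
  | 0, hh, y, b => ν ⟨0, hh⟩ y b
  | h + 1, hh, y, b =>
      G.seqY ν h (Nat.lt_of_succ_lt hh) (G.parentY h hh y).1 (G.parentY h hh y).2 *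
        ν ⟨h + 1, hh⟩ y b

open Classical in
/-- The loss function `ℓ_h(x_h, a_h)` induced by the min-player's policy `ν`. -/
def loss [Fintype B] (G : IIEFG H S X Y A B) (ν : Strategy H Y B) (h : Fin H) (x : X h) (a : A) :
    ℝ :=
  ∑ s : S h with G.infoX h s = x, ∑ b : B,
    G.transSeq h h.2 s * G.seqY ν h h.2 (G.infoY h s) b * (1 - G.meanReward h s a b)

/-- The inner product `⟨μ, ℓ⟩` over the sequence form of `μ`. -/
def pairing [∀ h, Fintype (X h)] [Fintype A] (G : IIEFG H S X Y A B) (μ : Strategy H X A)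
    (ℓ : ∀ h : Fin H, X h → A → ℝ) : ℝ :=
  ∑ h : Fin H, ∑ x : X h, ∑ a : A, G.seqX μ h h.2 x a * ℓ h x a

open Classical in
/-- `C_{h'}(x, a)`: the infosets of layer `h'` that are reachable from `(x, a)`. -/
def descAct [∀ h, Fintype (X h)] (G : IIEFG H S X Y A B) (h' : ℕ) {h : ℕ} (x : X h) (a : A) :
    Finset (X h') :=
  Finset.univ.filter fun x' => G.ReachX x a x'

open Classical in
/-- `C_{h'}(x)`, the union of the `C_{h'}(x, a)` over all actions `a`. -/
def desc [∀ h, Fintype (X h)] (G : IIEFG H S X Y A B) (h' : ℕ) {h : ℕ} (x : X h) :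
    Finset (X h') :=
  Finset.univ.filter fun x' => ∃ a : A, G.ReachX x a x'

/-- The balanced exploration policy for layer `h`. -/
def balanced [∀ h, Fintype (X h)] [Fintype A] (G : IIEFG H S X Y A B) (h : Fin H) :
    Strategy H X A :=
  fun k x a =>
    if k < h then ((G.descAct h x a).card : ℝ) / ((G.desc h x).card : ℝ)
    else 1 / (Fintype.card A : ℝ)

/-- The sampling policy `(μ^{⋆,h}_{1:h} μ_{h+1:H})`: the balanced exploration policy for layer `h`
up to and including layer `h`, then `μ`. -/
def samplingPolicy [∀ h, Fintype (X h)] [Fintype A] (G : IIEFG H S X Y A B) (μ : Strategy H X A)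
    (h : Fin H) : Strategy H X A :=
  fun k => if k ≤ h then G.balanced h k else μ k

open Classical in
/-- The estimator of the counterfactual loss at layer `h`, computed from the observation `o` of the
episode that was played with the sampling policy for layer `h`. -/
def lossEstimator [∀ h, Fintype (X h)] [Fintype A] (G : IIEFG H S X Y A B) (h : Fin H)
    (o : Observation H X A) (x : X h) (a : A) : ℝ :=
  (if (o h).1 = x ∧ (o h).2.1 = a then 1 else 0) / G.seqX (G.balanced h) h h.2 x a *
    ((H : ℝ) - (h : ℝ) - ∑ k : Fin H with h ≤ k, ((o k).2.2 : ℝ))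

/-- The policies maintained by Balanced CFR with Hedge and parameter `η`: uniform in round `0`, and
after round `t`, in which the observations `obs t h` (`h < H`) were made, the policy at each infoset
is updated by Hedge with learning rate `η μ^{⋆,h}_{1:h}(x_h, a)`. -/
def cfrPolicy [∀ h, Fintype (X h)] [Fintype A] (G : IIEFG H S X Y A B) (η : ℝ)
    (obs : ℕ → Fin H → Observation H X A) : ℕ → Strategy H X A
  | 0 => fun _ _ _ => 1 / (Fintype.card A : ℝ)
  | t + 1 => fun h x a =>
      let w : A → ℝ := fun a' => G.cfrPolicy η obs t h x a' *
        Real.exp (-(η * G.seqX (G.balanced h) h h.2 x a' * G.lossEstimator h (obs t h) x a'))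
      w a / ∑ a' : A, w a'

/-- The probability that an episode played with `(μ, ν)` follows the path `τ`. -/
def pathProb (G : IIEFG H S X Y A B) (μ : Strategy H X A) (ν : Strategy H Y B)
    (τ : GamePath H S A B) : ℝ :=
  G.init (τ ⟨0, G.H_pos⟩).1 *
    ∏ h : Fin H, (μ h (G.infoX h (τ h).1) (τ h).2.1 * ν h (G.infoY h (τ h).1) (τ h).2.2 *
      if hh : (h : ℕ) + 1 < H then
        G.trans h (τ h).1 (τ h).2.1 (τ h).2.2 (τ ⟨(h : ℕ) + 1, hh⟩).1
      else 1)

/-- The joint law of the rewards of an episode given its path: independent draws. -/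
def rewardLaw (G : IIEFG H S X Y A B) (τ : GamePath H S A B) : Measure (Fin H → I) :=
  Measure.pi fun h : Fin H => (G.reward h (τ h).1 (τ h).2.1 (τ h).2.2 : Measure I)

/-- The max-player's view of an episode with path `τ` and rewards `r`. -/
def observe (G : IIEFG H S X Y A B) (τ : GamePath H S A B) (r : Fin H → I) : Observation H X A :=
  fun h => (G.infoX h (τ h).1, (τ h).2.1, r h)

variable [∀ h, Fintype (X h)] [Fintype A] [Fintype B] {Ω : Type*}

/-- The policy `μ^t` maintained by Balanced CFR in round `t`, as a function of the paths and rewards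
of the episodes `(t', h)` played in the rounds `t' < t`. -/
def maintained (G : IIEFG H S X Y A B) (η : ℝ) (path : ℕ → Fin H → Ω → GamePath H S A B)
    (rew : ℕ → Fin H → Ω → Fin H → I) (t : ℕ) (ω : Ω) : Strategy H X A :=
  G.cfrPolicy η (fun t' h => G.observe (path t' h ω) (rew t' h ω)) t

/-- The max-player runs `T` rounds of Balanced CFR with Hedge and parameter `η` against an adaptive
opponent. Round `t < T` consists of the episodes `(t, h)`, `h < H`, played in this order, and
`ℱ (t * H + h)` is the information (including that of the opponent) available before episode
`(t, h)`. The opponent fixes her policy `ν t` before round `t` based on all past information, and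
given the past, episode `(t, h)` is played with the sampling policy for layer `h` and with `ν t`. -/
structure IsBalancedCFRRun (G : IIEFG H S X Y A B) {m : MeasurableSpace Ω} (P : Measure Ω)
    (ℱ : Filtration ℕ m) (T : ℕ) (η : ℝ) (ν : ℕ → Ω → Strategy H Y B)
    (path : ℕ → Fin H → Ω → GamePath H S A B) (rew : ℕ → Fin H → Ω → Fin H → I) : Prop where
  opponent_mem : ∀ t < T, ∀ ω, ν t ω ∈ policies H Y B
  opponent_meas : ∀ t < T, ∀ (h : Fin H) (y : Y h) (b : B),
    Measurable[ℱ (t * H)] fun ω => ν t ω h y b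
  path_meas : ∀ t < T, ∀ (h : Fin H) (τ : GamePath H S A B),
    MeasurableSet[ℱ (t * H + h + 1)] {ω | path t h ω = τ}
  rew_meas : ∀ t < T, ∀ h : Fin H, Measurable[ℱ (t * H + h + 1)] (rew t h)
  episode_law : ∀ t < T, ∀ (h : Fin H) (τ : GamePath H S A B) (E : Set (Fin H → I)),
    MeasurableSet E →
      P⟦{ω | path t h ω = τ ∧ rew t h ω ∈ E} | ℱ (t * H + h)⟧ =ᵐ[P] fun ω =>
        G.pathProb (G.samplingPolicy (G.maintained η path rew t ω) h) (ν t ω) τ *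
          (G.rewardLaw τ).real E

/-- The total number of infosets of the max-player. -/
def numInfosets (H : ℕ) (X : ℕ → Type*) [∀ h, Fintype (X h)] : ℕ :=
  ∑ h : Fin H, Fintype.card (X h)

end IIEFG

end

/-! Passing from the maintained policy to a comparator one layer at a time turns the regret into a
sum of local regrets at the pairs (x, a), weighted by the comparator's sequence form
(`pairing_sub_pairing`, `pairing_sub_pairing_eq_localRegret`). It therefore suffices to control one
local regret per pair. The weights enter only afterwards, so a union bound over finitely many pairs
covers all comparators at once.

At one infoset the learning rate contains the very factor by which the estimator divides
(`seqX_mul_lossEstimator`). The Hedge exponent is thus `η` times an observed loss in [0, H], and no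
large importance weight appears. The Hedge potential bounds the sum of the log-normalizers and of
`η` times the observed losses of `a` below by -log A. Both sums are bounded above by an exponential
Markov inequality: e^u ≤ 1 + u + u² controls each increment, and `IsBalancedCFRRun.condExp_visit`
identifies the conditional mean of this majorant through true counterfactual losses and visit
probabilities. Adding the two bounds gives `IsBalancedCFRRun.measure_localRegret`: a term inversely
proportional to the balanced reach weight, plus a second-order term proportional to the visit
probabilities.

Summation against the comparator tames both terms. Ratios of its sequence form to the balanced one
add up to |X_h| A in each layer (`sum_seqX_div_balanced`), and its visit probabilities add up to 1
(`sum_priorX_mul_visitProb`). The result has order XAι/η + ηH³T, which the given `η` balances. If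
that `η` exceeds 1/H, the trivial bound HT is already good enough. -/

noncomputable section

/-! ### Path sums of finite chains -/

section Chain

variable {Q : ℕ → Type*}

/-- The weight of a path under an initial weight and a sequence of transition weights. -/
def chainWeight (f : Q 0 → ℝ) (M : ∀ h, Q h → Q (h + 1) → ℝ) (n : ℕ)
    (τ : ∀ h : Fin (n + 1), Q h) : ℝ :=
  f (τ ⟨0, n.succ_pos⟩) *
    ∏ i : Fin n, M i (τ ⟨i, i.2.trans n.lt_succ_self⟩) (τ ⟨i + 1, Nat.succ_lt_succ i.2⟩)

theorem chainWeight_snoc (f : Q 0 → ℝ) (M : ∀ h, Q h → Q (h + 1) → ℝ) (n : ℕ)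
    (τ : ∀ h : Fin (n + 1), Q h) (q : Q (n + 1)) :
    chainWeight f M (n + 1) (Fin.snoc (α := fun h : Fin (n + 2) => Q h) τ q) =
      chainWeight f M n τ * M n (τ (Fin.last n)) q := by
  have e : ∀ (k : ℕ) (hk : k < n + 1), (Fin.snoc (α := fun h : Fin (n + 2) => Q h) τ q)
      ⟨k, hk.trans (n + 1).lt_succ_self⟩ = τ ⟨k, hk⟩ := fun k hk =>
    Fin.snoc_castSucc (α := fun h : Fin (n + 2) => Q h) q τ ⟨k, hk⟩
  have e' : (Fin.snoc (α := fun h : Fin (n + 2) => Q h) τ q)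
      ⟨n + 1, (n + 1).lt_succ_self⟩ = q := Fin.snoc_last (α := fun h : Fin (n + 2) => Q h) q τ
  unfold chainWeight
  rw [Fin.prod_univ_castSucc, ← mul_assoc]
  congr 1
  · rw [e 0 n.succ_pos]
    congr 1
    refine Finset.prod_congr rfl fun i _ => ?_
    have h1 := e i (i.2.trans n.lt_succ_self)
    have h2 := e (i + 1) (Nat.succ_lt_succ i.2)
    simp only [Fin.val_castSucc]
    rw [h1, h2]
  · have h1 := e n n.lt_succ_self
    simp only [Fin.val_last]
    rw [h1, e']
    rfl

variable [∀ h, Fintype (Q h)]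

theorem sum_snoc (n : ℕ) (F : (∀ h : Fin (n + 2), Q h) → ℝ) :
    ∑ τ, F τ = ∑ τ : ∀ h : Fin (n + 1), Q h, ∑ q : Q (n + 1),
      F (Fin.snoc (α := fun h : Fin (n + 2) => Q h) τ q) := by
  rw [Finset.sum_comm, ← Fintype.sum_prod_type']
  exact (Equiv.sum_comp (Fin.snocEquiv fun h : Fin (n + 2) => Q h) F).symm

/-- Summing out the coordinates in order turns the path weight into the forward weight `α`. The
transition weights need not be normalized. -/
theorem sum_chainWeight_last (f : Q 0 → ℝ) (M : ∀ h, Q h → Q (h + 1) → ℝ) (α : ∀ h, Q h → ℝ)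
    (h0 : ∀ q, α 0 q = f q) (n : ℕ)
    (hα : ∀ h < n, ∀ q', ∑ q, α h q * M h q q' = α (h + 1) q') (g : Q n → ℝ) :
    ∑ τ, chainWeight f M n τ * g (τ (Fin.last n)) = ∑ q, α n q * g q := by
  induction n with
  | zero =>
    rw [← Equiv.sum_comp (Equiv.piUnique fun h : Fin 1 => Q h).symm]
    refine Finset.sum_congr rfl fun q _ => ?_
    rw [h0]
    simp only [chainWeight, Finset.univ_eq_empty, Finset.prod_empty, mul_one]
    rfl
  | succ n ih =>
    rw [sum_snoc]
    simp only [chainWeight_snoc, Fin.snoc_last]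
    rw [Finset.sum_comm]
    refine Finset.sum_congr rfl fun q' _ => ?_
    rw [← Finset.sum_mul, ih (fun h hh => hα h (hh.trans n.lt_succ_self)) fun q => M n q q',
      hα n n.lt_succ_self]

/-- The layers after `k` are summed out from the end. Normalization is asked only there, which
leaves room for strategies deliberately cut down at an earlier layer. -/
theorem sum_chainWeight (f : Q 0 → ℝ) (M : ∀ h, Q h → Q (h + 1) → ℝ) (α : ∀ h, Q h → ℝ)
    (h0 : ∀ q, α 0 q = f q) (n k : ℕ) (hk : k ≤ n)
    (hα : ∀ h < n, ∀ q', ∑ q, α h q * M h q q' = α (h + 1) q')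
    (hM : ∀ j, k ≤ j → j < n → ∀ q, ∑ q', M j q q' = 1) (g : Q k → ℝ) :
    ∑ τ, chainWeight f M n τ * g (τ ⟨k, Nat.lt_succ_of_le hk⟩) = ∑ q, α k q * g q := by
  induction n, hk using Nat.le_induction with
  | base => exact sum_chainWeight_last f M α h0 k hα g
  | succ n hk ih =>
    rw [sum_snoc, ← ih (fun h hh => hα h (hh.trans n.lt_succ_self))
      fun j hj hn => hM j hj (hn.trans n.lt_succ_self)]
    refine Finset.sum_congr rfl fun τ _ => ?_
    have e : ∀ q, (Fin.snoc (α := fun h : Fin (n + 2) => Q h) τ q)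
        ⟨k, Nat.lt_succ_of_le (hk.trans n.le_succ)⟩ = τ ⟨k, Nat.lt_succ_of_le hk⟩ := fun q =>
      Fin.snoc_castSucc (α := fun h : Fin (n + 2) => Q h) q τ ⟨k, Nat.lt_succ_of_le hk⟩
    simp only [chainWeight_snoc, e]
    rw [← Finset.sum_mul, ← Finset.mul_sum, hM n hk n.lt_succ_self, mul_one]

end Chain

/-! ### Sequence forms and the marginals of an episode -/

namespace IIEFG

variable {H : ℕ} {S X Y : ℕ → Type*} {A B : Type*} [∀ h, Fintype (S h)]

theorem trans_nonneg (G : IIEFG H S X Y A B) {h : ℕ} (hh : h + 1 < H) (s : S h) (a : A) (b : B)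
    (s' : S (h + 1)) : 0 ≤ G.trans h s a b s' :=
  (G.trans_mem h hh s a b).1 s'

theorem sum_trans (G : IIEFG H S X Y A B) {h : ℕ} (hh : h + 1 < H) (s : S h) (a : A) (b : B) :
    ∑ s', G.trans h s a b s' = 1 :=
  (G.trans_mem h hh s a b).2

theorem parentS_spec (G : IIEFG H S X Y A B) (h : ℕ) (hh : h + 1 < H) (s' : S (h + 1)) :
    0 < G.trans h (G.parentS h hh s').1 (G.parentS h hh s').2.1 (G.parentS h hh s').2.2 s' :=
  (G.tree h hh s').choose_spec.1

theorem trans_eq_zero (G : IIEFG H S X Y A B) (h : ℕ) (hh : h + 1 < H) (s' : S (h + 1))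
    (q : S h × A × B) (hq : q ≠ G.parentS h hh s') : G.trans h q.1 q.2.1 q.2.2 s' = 0 := by
  by_contra hne
  exact hq ((G.tree h hh s').choose_spec.2 q
    (lt_of_le_of_ne (G.trans_nonneg hh _ _ _ _) (Ne.symm hne)))

theorem stepX_parentX (G : IIEFG H S X Y A B) (h : ℕ) (hh : h + 1 < H) (x' : X (h + 1)) :
    G.StepX (G.parentX h hh x').1 (G.parentX h hh x').2 x' :=
  (G.recallX h hh x').choose_spec.1

theorem parentX_eq (G : IIEFG H S X Y A B) {h : ℕ} (hh : h + 1 < H) {x : X h} {a : A}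
    {x' : X (h + 1)} (hs : G.StepX x a x') : G.parentX h hh x' = (x, a) :=
  ((G.recallX h hh x').choose_spec.2 (x, a) hs).symm

theorem parentY_eq (G : IIEFG H S X Y A B) {h : ℕ} (hh : h + 1 < H) {y : Y h} {b : B}
    {y' : Y (h + 1)} (hs : G.StepY y b y') : G.parentY h hh y' = (y, b) :=
  ((G.recallY h hh y').choose_spec.2 (y, b) hs).symm

theorem parentX_infoX (G : IIEFG H S X Y A B) (h : ℕ) (hh : h + 1 < H) (s' : S (h + 1)) :
    G.parentX h hh (G.infoX (h + 1) s') =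
      (G.infoX h (G.parentS h hh s').1, (G.parentS h hh s').2.1) :=
  G.parentX_eq hh ⟨_, _, s', rfl, rfl, G.parentS_spec h hh s'⟩

theorem parentY_infoY (G : IIEFG H S X Y A B) (h : ℕ) (hh : h + 1 < H) (s' : S (h + 1)) :
    G.parentY h hh (G.infoY (h + 1) s') =
      (G.infoY h (G.parentS h hh s').1, (G.parentS h hh s').2.2) :=
  G.parentY_eq hh ⟨_, _, s', rfl, rfl, G.parentS_spec h hh s'⟩

/-- By the tree structure all terms except the one of the unique predecessor vanish. This converts
forward sums over predecessors into the recursions that follow histories backwards. -/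
theorem sum_mul_trans [Fintype A] [Fintype B] (G : IIEFG H S X Y A B) (h : ℕ) (hh : h + 1 < H)
    (s' : S (h + 1)) (F : S h × A × B → ℝ) :
    ∑ q, F q * G.trans h q.1 q.2.1 q.2.2 s' =
      F (G.parentS h hh s') * G.trans h (G.parentS h hh s').1 (G.parentS h hh s').2.1
        (G.parentS h hh s').2.2 s' :=
  Finset.sum_eq_single _ (fun q _ hq => by rw [G.trans_eq_zero h hh s' q hq, mul_zero])
    fun hq => absurd (Finset.mem_univ _) hq

/-- Sequence form of a strategy of the max-player up to, and excluding, the infoset `x`. -/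
def priorX (G : IIEFG H S X Y A B) (μ : Strategy H X A) : ∀ h : ℕ, h < H → X h → ℝ
  | 0, _, _ => 1
  | h + 1, hh, x =>
      G.seqX μ h (Nat.lt_of_succ_lt hh) (G.parentX h hh x).1 (G.parentX h hh x).2

/-- Sequence form of a strategy of the min-player up to, and excluding, the infoset `y`. -/
def priorY (G : IIEFG H S X Y A B) (ν : Strategy H Y B) : ∀ h : ℕ, h < H → Y h → ℝ
  | 0, _, _ => 1
  | h + 1, hh, y =>
      G.seqY ν h (Nat.lt_of_succ_lt hh) (G.parentY h hh y).1 (G.parentY h hh y).2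

theorem seqX_eq (G : IIEFG H S X Y A B) (μ : Strategy H X A) (h : ℕ) (hh : h < H) (x : X h)
    (a : A) : G.seqX μ h hh x a = G.priorX μ h hh x * μ ⟨h, hh⟩ x a := by
  cases h with
  | zero => simp [seqX, priorX]
  | succ h => rfl

theorem seqY_eq (G : IIEFG H S X Y A B) (ν : Strategy H Y B) (h : ℕ) (hh : h < H) (y : Y h)
    (b : B) : G.seqY ν h hh y b = G.priorY ν h hh y * ν ⟨h, hh⟩ y b := by
  cases h with
  | zero => simp [seqY, priorY]
  | succ h => rfl

theorem transSeq_nonneg (G : IIEFG H S X Y A B) (h : ℕ) (hh : h < H) (s : S h) :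
    0 ≤ G.transSeq h hh s := by
  induction h with
  | zero => exact G.init_mem.1 s
  | succ h ih => exact mul_nonneg (ih _ _) (G.trans_nonneg hh _ _ _ _)

theorem seqX_nonneg (G : IIEFG H S X Y A B) {μ : Strategy H X A} (hμ : ∀ h x a, 0 ≤ μ h x a)
    (h : ℕ) (hh : h < H) (x : X h) (a : A) : 0 ≤ G.seqX μ h hh x a := by
  induction h generalizing a with
  | zero => exact hμ _ _ _
  | succ h ih => exact mul_nonneg (ih _ _ _) (hμ _ _ _)

theorem seqY_nonneg (G : IIEFG H S X Y A B) {ν : Strategy H Y B} (hν : ∀ h y b, 0 ≤ ν h y b)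
    (h : ℕ) (hh : h < H) (y : Y h) (b : B) : 0 ≤ G.seqY ν h hh y b := by
  induction h generalizing b with
  | zero => exact hν _ _ _
  | succ h ih => exact mul_nonneg (ih _ _ _) (hν _ _ _)

variable [Fintype A] [Fintype B]

theorem sum_transSeq_mul_prior (G : IIEFG H S X Y A B) {μ : Strategy H X A} {ν : Strategy H Y B}
    (hμ : μ ∈ policies H X A) (hν : ν ∈ policies H Y B) (h : ℕ) (hh : h < H) :
    ∑ s, G.transSeq h hh s * (G.priorX μ h hh (G.infoX h s) * G.priorY ν h hh (G.infoY h s)) =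
      1 := by
  induction h with
  | zero => simpa [transSeq, priorX, priorY] using G.init_mem.2
  | succ h ih =>
    have hh' := Nat.lt_of_succ_lt hh
    let F : S h × A × B → ℝ := fun q => G.transSeq h hh' q.1 *
      (G.seqX μ h hh' (G.infoX h q.1) q.2.1 * G.seqY ν h hh' (G.infoY h q.1) q.2.2)
    calc _ = ∑ s', ∑ q, F q * G.trans h q.1 q.2.1 q.2.2 s' := by
          refine Finset.sum_congr rfl fun s' _ => ?_
          rw [G.sum_mul_trans h hh s' F]
          simp only [transSeq, priorX, priorY, parentX_infoX, parentY_infoY, F]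
          ring
      _ = ∑ q, F q := by
          rw [Finset.sum_comm]
          refine Finset.sum_congr rfl fun q _ => ?_
          rw [← Finset.mul_sum, G.sum_trans hh, mul_one]
      _ = 1 := by
          rw [← ih hh']
          simp only [Fintype.sum_prod_type, F]
          refine Finset.sum_congr rfl fun s _ => ?_
          simp only [seqX_eq, seqY_eq]
          have e1 := (hμ ⟨h, hh'⟩ (G.infoX h s)).2
          have e2 := (hν ⟨h, hh'⟩ (G.infoY h s)).2
          have e : (∑ a, μ ⟨h, hh'⟩ (G.infoX h s) a) * ∑ b, ν ⟨h, hh'⟩ (G.infoY h s) b = 1 := by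
            rw [e1, e2, mul_one]
          rw [← mul_one (G.transSeq h hh' s * (G.priorX μ h hh' (G.infoX h s) *
            G.priorY ν h hh' (G.infoY h s))), ← e, Finset.sum_mul_sum, Finset.mul_sum]
          refine Finset.sum_congr rfl fun a _ => ?_
          rw [Finset.mul_sum]
          exact Finset.sum_congr rfl fun b _ => by ring

/-- Marginal of the law of an episode at layer `k`, for strategies which are probability
distributions after layer `k`. -/
theorem sum_pathProb_mul (G : IIEFG H S X Y A B) (μ : Strategy H X A) (ν : Strategy H Y B)
    (k : Fin H) (hμ : ∀ j > k, ∀ x, ∑ a, μ j x a = 1) (hν : ∀ j > k, ∀ y, ∑ b, ν j y b = 1)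
    (g : S k × A × B → ℝ) :
    ∑ τ, G.pathProb μ ν τ * g (τ k) = ∑ q : S k × A × B, G.transSeq k k.2 q.1 *
      (G.seqX μ k k.2 (G.infoX k q.1) q.2.1 * G.seqY ν k k.2 (G.infoY k q.1) q.2.2) * g q := by
  obtain ⟨n, rfl⟩ : ∃ n, H = n + 1 := ⟨H - 1, by have := G.H_pos; omega⟩
  let K : ∀ h, h < n + 1 → S h × A × B → ℝ := fun h hh q =>
    μ ⟨h, hh⟩ (G.infoX h q.1) q.2.1 * ν ⟨h, hh⟩ (G.infoY h q.1) q.2.2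
  let f : S 0 × A × B → ℝ := fun q => G.init q.1 * K 0 n.succ_pos q
  -- The action probabilities of layer h + 1 are attached to the transition entering that layer;
  -- those of layer 0 sit in `f`. The value beyond the horizon is never used.
  let M : ∀ h, S h × A × B → S (h + 1) × A × B → ℝ := fun h q q' =>
    if hh : h + 1 < n + 1 then G.trans h q.1 q.2.1 q.2.2 q'.1 * K (h + 1) hh q' else 0
  let α : ∀ h, S h × A × B → ℝ := fun h q => if hh : h < n + 1 then
    G.transSeq h hh q.1 *
      (G.seqX μ h hh (G.infoX h q.1) q.2.1 * G.seqY ν h hh (G.infoY h q.1) q.2.2) else 0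
  have hpath : ∀ τ, G.pathProb μ ν τ = chainWeight (Q := fun h => S h × A × B) f M n τ := by
    intro τ
    have e1 : ∏ h : Fin (n + 1), K h h.2 (τ h) = K 0 n.succ_pos (τ ⟨0, n.succ_pos⟩) *
        ∏ i : Fin n, K (i + 1) (Nat.succ_lt_succ i.2) (τ ⟨i + 1, Nat.succ_lt_succ i.2⟩) := by
      rw [Fin.prod_univ_succ]; rfl
    have e2 : ∏ h : Fin (n + 1), (if hh : (h : ℕ) + 1 < n + 1 then
        G.trans h (τ h).1 (τ h).2.1 (τ h).2.2 (τ ⟨(h : ℕ) + 1, hh⟩).1 else 1) =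
        ∏ i : Fin n, G.trans i (τ ⟨i, i.2.trans n.lt_succ_self⟩).1
          (τ ⟨i, i.2.trans n.lt_succ_self⟩).2.1 (τ ⟨i, i.2.trans n.lt_succ_self⟩).2.2
          (τ ⟨i + 1, Nat.succ_lt_succ i.2⟩).1 := by
      rw [Fin.prod_univ_castSucc, dif_neg (by simp), mul_one]
      refine Finset.prod_congr rfl fun i _ => ?_
      exact dif_pos (Nat.succ_lt_succ i.2)
    unfold pathProb chainWeight
    rw [Finset.prod_mul_distrib, e2]
    change _ * ((∏ h : Fin (n + 1), K h h.2 (τ h)) * _) = _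
    rw [e1]
    have e3 : ∏ i : Fin n, M i (τ ⟨i, i.2.trans n.lt_succ_self⟩)
        (τ ⟨i + 1, Nat.succ_lt_succ i.2⟩) =
        (∏ i : Fin n, G.trans i (τ ⟨i, i.2.trans n.lt_succ_self⟩).1
          (τ ⟨i, i.2.trans n.lt_succ_self⟩).2.1 (τ ⟨i, i.2.trans n.lt_succ_self⟩).2.2
          (τ ⟨i + 1, Nat.succ_lt_succ i.2⟩).1) *
        ∏ i : Fin n, K (i + 1) (Nat.succ_lt_succ i.2) (τ ⟨i + 1, Nat.succ_lt_succ i.2⟩) := by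
      rw [← Finset.prod_mul_distrib]
      exact Finset.prod_congr rfl fun i _ => dif_pos (Nat.succ_lt_succ i.2)
    rw [e3]
    simp only [f]
    ring
  have hα0 : ∀ q, α 0 q = f q := fun q => by
    simp only [α, f, K, dif_pos n.succ_pos, transSeq, seqX, seqY]
  have hα : ∀ h < n, ∀ q', ∑ q, α h q * M h q q' = α (h + 1) q' := by
    intro h hn q'
    have hh : h + 1 < n + 1 := Nat.succ_lt_succ hn
    have hh' : h < n + 1 := Nat.lt_of_succ_lt hh
    simp only [α, M, dif_pos hh, dif_pos hh']
    simp_rw [← mul_assoc, ← Finset.sum_mul]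
    rw [G.sum_mul_trans h hh q'.1]
    simp only [transSeq, seqX, seqY, parentX_infoX, parentY_infoY, K]
    ring
  have hM : ∀ j, (k : ℕ) ≤ j → j < n → ∀ q, ∑ q', M j q q' = 1 := by
    intro j hkj hjn q
    have hh : j + 1 < n + 1 := Nat.succ_lt_succ hjn
    have hlt : (⟨j + 1, hh⟩ : Fin (n + 1)) > k := Nat.lt_succ_of_le hkj
    simp only [M, dif_pos hh, K, Fintype.sum_prod_type]
    simp_rw [← Finset.mul_sum, hν _ hlt, mul_one, hμ _ hlt, mul_one]
    exact G.sum_trans hh _ _ _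
  have key := sum_chainWeight (Q := fun h => S h × A × B) f M α hα0 n k
    (Nat.le_of_lt_succ k.2) hα hM g
  simp_rw [hpath]
  refine key.trans (Finset.sum_congr rfl fun q _ => ?_)
  simp only [α, dif_pos k.2]

end IIEFG

/-! ### Reachability between infosets and the balancing property -/

namespace IIEFG

variable {H : ℕ} {S X Y : ℕ → Type*} {A B : Type*} [∀ h, Fintype (S h)]

theorem lt_of_reachX (G : IIEFG H S X Y A B) {k h : ℕ} {x : X k} {a : A} {z : X h}
    (hr : G.ReachX x a z) : k < h := by
  induction hr with
  | child _ => exact Nat.lt_succ_self _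
  | step _ _ ih => exact ih.trans (Nat.lt_succ_self _)

theorem reachX_of_stepX (G : IIEFG H S X Y A B) {k h : ℕ} {x : X k} {a : A} {x' : X (k + 1)}
    {a' : A} {z : X h} (hs : G.StepX x a x') (hr : G.ReachX x' a' z) : G.ReachX x a z := by
  induction hr with
  | child h' => exact .step (.child hs) h'
  | step _ h' ih => exact .step ih h'

/-- Perfect recall gives a unique immediate predecessor, and iteration gives a unique one in every
earlier layer. The sets of descendants are thus fibres of a map, which makes counting them additive.
-/
theorem existsUnique_reachX (G : IIEFG H S X Y A B) (k h : ℕ) (hk : k < h) (hh : h < H)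
    (z : X h) : ∃! q : X k × A, G.ReachX q.1 q.2 z := by
  induction h with
  | zero => exact absurd hk (Nat.not_lt_zero _)
  | succ h ih =>
    rcases Nat.lt_succ_iff_lt_or_eq.1 hk with hlt | rfl
    · obtain ⟨q, hq, hu⟩ := ih hlt (Nat.lt_of_succ_lt hh) (G.parentX h hh z).1
      refine ⟨q, .step hq (G.stepX_parentX h hh z), fun q' hq' => hu q' ?_⟩
      cases hq' with
      | child _ => exact absurd hlt (lt_irrefl _)
      | step hr hs => rw [G.parentX_eq hh hs]; exact hr
    · refine ⟨G.parentX k hh z, .child (G.stepX_parentX k hh z), fun q' hq' => ?_⟩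
      cases hq' with
      | child hs => exact (G.parentX_eq hh hs).symm
      | step hr _ => exact absurd (G.lt_of_reachX hr) (lt_irrefl _)

/-- The infoset of layer `k` and the action through which the infoset `z` is reached. -/
def ancestor (G : IIEFG H S X Y A B) {k h : ℕ} (hk : k < h) (hh : h < H) (z : X h) : X k × A :=
  (G.existsUnique_reachX k h hk hh z).choose

theorem reachX_iff (G : IIEFG H S X Y A B) {k h : ℕ} (hk : k < h) (hh : h < H) (x : X k) (a : A)
    (z : X h) : G.ReachX x a z ↔ G.ancestor hk hh z = (x, a) := by
  have hs := (G.existsUnique_reachX k h hk hh z).choose_spec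
  refine ⟨fun hr => (hs.2 (x, a) hr).symm, fun e => ?_⟩
  have := hs.1
  change G.ReachX (G.ancestor hk hh z).1 (G.ancestor hk hh z).2 z at this
  rwa [e] at this

theorem reachX_ancestor (G : IIEFG H S X Y A B) {k h : ℕ} (hk : k < h) (hh : h < H) (z : X h) :
    G.ReachX (G.ancestor hk hh z).1 (G.ancestor hk hh z).2 z :=
  (G.reachX_iff hk hh _ _ z).2 rfl

theorem parentX_ancestor (G : IIEFG H S X Y A B) {k h : ℕ} (hk : k + 1 < h) (hh : h < H)
    (z : X h) : G.parentX k (hk.trans hh) (G.ancestor hk hh z).1 =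
      G.ancestor (Nat.lt_of_succ_lt hk) hh z :=
  ((G.reachX_iff (Nat.lt_of_succ_lt hk) hh _ _ z).1 (G.reachX_of_stepX
    (G.stepX_parentX k (hk.trans hh) _) (G.reachX_ancestor hk hh z))).symm

theorem parentX_eq_ancestor (G : IIEFG H S X Y A B) {k : ℕ} (hh : k + 1 < H) (z : X (k + 1)) :
    G.parentX k hh z = G.ancestor (Nat.lt_succ_self k) hh z :=
  ((G.reachX_iff (Nat.lt_succ_self k) hh _ _ z).1 (.child (G.stepX_parentX k hh z))).symm

/-- Infosets contain a state and transition probabilities add up to 1, so no pair dies out before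
the horizon. This is why the balanced policies are strictly positive. -/
theorem exists_stepX [Nonempty B] (G : IIEFG H S X Y A B) {k : ℕ} (hk : k + 1 < H) (x : X k)
    (a : A) : ∃ x', G.StepX x a x' := by
  obtain ⟨s, hs⟩ := G.infoX_surj k (Nat.lt_of_succ_lt hk) x
  obtain ⟨b⟩ := ‹Nonempty B›
  have h1 : ∑ s', G.trans k s a b s' ≠ 0 := by rw [G.sum_trans hk]; exact one_ne_zero
  obtain ⟨s', -, hs'⟩ := Finset.exists_ne_zero_of_sum_ne_zero h1
  exact ⟨_, s, b, s', hs, rfl, lt_of_le_of_ne (G.trans_nonneg hk _ _ _ _) hs'.symm⟩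

theorem exists_reachX [Nonempty A] [Nonempty B] (G : IIEFG H S X Y A B) {k h : ℕ} (hk : k < h)
    (hh : h < H) (x : X k) (a : A) : ∃ z : X h, G.ReachX x a z := by
  induction h with
  | zero => exact absurd hk (Nat.not_lt_zero _)
  | succ h ih =>
    rcases Nat.lt_succ_iff_lt_or_eq.1 hk with hlt | rfl
    · obtain ⟨z, hz⟩ := ih hlt (Nat.lt_of_succ_lt hh)
      obtain ⟨a'⟩ := ‹Nonempty A›
      obtain ⟨z', hz'⟩ := G.exists_stepX hh z a'
      exact ⟨z', .step hz hz'⟩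
    · obtain ⟨z', hz'⟩ := G.exists_stepX hh x a
      exact ⟨z', .child hz'⟩

variable [∀ h, Fintype (X h)]

open Classical in
theorem descAct_eq (G : IIEFG H S X Y A B) {k h : ℕ} (hk : k < h) (hh : h < H) (x : X k) (a : A) :
    G.descAct h x a = Finset.univ.filter fun z : X h => G.ancestor hk hh z = (x, a) := by
  ext z
  simp only [descAct, Finset.mem_filter, Finset.mem_univ, true_and, G.reachX_iff hk hh]

open Classical in
theorem desc_eq (G : IIEFG H S X Y A B) {k h : ℕ} (hk : k < h) (hh : h < H) (x : X k) :
    G.desc h x = Finset.univ.filter fun z : X h => (G.ancestor hk hh z).1 = x := by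
  ext z
  simp only [desc, Finset.mem_filter, Finset.mem_univ, true_and, G.reachX_iff hk hh]
  exact ⟨fun ⟨a, e⟩ => by rw [e], fun e => ⟨(G.ancestor hk hh z).2, by rw [← e]⟩⟩

theorem card_descAct_pos [Nonempty A] [Nonempty B] (G : IIEFG H S X Y A B) {k h : ℕ} (hk : k < h)
    (hh : h < H) (x : X k) (a : A) : 0 < (G.descAct h x a).card := by
  classical
  obtain ⟨z, hz⟩ := G.exists_reachX hk hh x a
  exact Finset.card_pos.2 ⟨z, by simpa [descAct] using hz⟩

variable [Fintype A]

theorem card_desc (G : IIEFG H S X Y A B) {k h : ℕ} (hk : k < h) (hh : h < H) (x : X k) :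
    (G.desc h x).card = ∑ a, (G.descAct h x a).card := by
  classical
  have e : G.desc h x = Finset.univ.biUnion fun a => G.descAct h x a := by
    ext z
    simp [desc, descAct]
  rw [e, Finset.card_biUnion]
  intro a _ a' _ hne
  rw [Function.onFun, Finset.disjoint_left]
  intro z hz hz'
  rw [G.descAct_eq hk hh, Finset.mem_filter] at hz hz'
  exact hne (congrArg Prod.snd (hz.2.symm.trans hz'.2))

theorem seqX_balanced_self (G : IIEFG H S X Y A B) (h : Fin H) (x : X h) (a : A) :
    G.seqX (G.balanced h) h h.2 x a = G.priorX (G.balanced h) h h.2 x / Fintype.card A := by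
  have e : G.balanced h h x a = 1 / (Fintype.card A : ℝ) := if_neg (lt_irrefl h)
  rw [seqX_eq, e, mul_one_div]

variable [Nonempty A] [Nonempty B]

theorem card_desc_pos (G : IIEFG H S X Y A B) {k h : ℕ} (hk : k < h) (hh : h < H) (x : X k) :
    0 < (G.desc h x).card := by
  rw [G.card_desc hk hh]
  exact Finset.sum_pos (fun a _ => G.card_descAct_pos hk hh x a) Finset.univ_nonempty

theorem balanced_pos (G : IIEFG H S X Y A B) (h k : Fin H) (x : X k) (a : A) :
    0 < G.balanced h k x a := by
  unfold balanced
  split_ifs with hk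
  · exact div_pos (Nat.cast_pos.2 (G.card_descAct_pos hk h.2 x a))
      (Nat.cast_pos.2 (G.card_desc_pos hk h.2 x))
  · exact one_div_pos.2 (Nat.cast_pos.2 Fintype.card_pos)

theorem balanced_mem_policies (G : IIEFG H S X Y A B) (h : Fin H) :
    G.balanced h ∈ policies H X A := by
  refine fun k x => ⟨fun a => (G.balanced_pos h k x a).le, ?_⟩
  unfold balanced
  split_ifs with hk
  · rw [← Finset.sum_div, ← Nat.cast_sum, ← G.card_desc hk h.2]
    exact div_self (Nat.cast_pos.2 (G.card_desc_pos hk h.2 x)).ne'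
  · simp

theorem seqX_balanced_pos (G : IIEFG H S X Y A B) (i : Fin H) (h : ℕ) (hh : h < H) (x : X h)
    (a : A) : 0 < G.seqX (G.balanced i) h hh x a := by
  induction h generalizing a with
  | zero => exact G.balanced_pos _ _ _ _
  | succ h ih => exact mul_pos (ih _ _ _) (G.balanced_pos _ _ _ _)

theorem priorX_balanced_pos (G : IIEFG H S X Y A B) (i : Fin H) (h : ℕ) (hh : h < H) (x : X h) :
    0 < G.priorX (G.balanced i) h hh x := by
  cases h with
  | zero => exact zero_lt_one
  | succ h => exact G.seqX_balanced_pos _ _ _ _ _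

/-- Group `z` by its ancestor. The pair (x, a) occurs |C(x, a)| times, and the balanced denominator
contributes |C(x)| / |C(x, a)|. The counts cancel to |C(x)| times the ratio of the prior weights
times μ(a | x), and the last factor sums to 1 over `a`. -/
theorem sum_seqX_div_ancestor (G : IIEFG H S X Y A B) {μ : Strategy H X A}
    (hμ : μ ∈ policies H X A) (h : Fin H) (k : ℕ) (hk : k < h) :
    ∑ z : X h, G.seqX μ k (hk.trans h.2) (G.ancestor hk h.2 z).1 (G.ancestor hk h.2 z).2 /
        G.seqX (G.balanced h) k (hk.trans h.2) (G.ancestor hk h.2 z).1 (G.ancestor hk h.2 z).2 =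
      ∑ z : X h, G.priorX μ k (hk.trans h.2) (G.ancestor hk h.2 z).1 /
        G.priorX (G.balanced h) k (hk.trans h.2) (G.ancestor hk h.2 z).1 := by
  classical
  have hkH := hk.trans h.2
  rw [← Finset.sum_fiberwise' Finset.univ (fun z => G.ancestor hk h.2 z)
      fun q : X k × A => G.seqX μ k hkH q.1 q.2 / G.seqX (G.balanced h) k hkH q.1 q.2,
    ← Finset.sum_fiberwise' Finset.univ (fun z => (G.ancestor hk h.2 z).1)
      fun x : X k => G.priorX μ k hkH x / G.priorX (G.balanced h) k hkH x,
    Fintype.sum_prod_type]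
  refine Finset.sum_congr rfl fun x _ => ?_
  have e : ∀ a, G.balanced h ⟨k, hkH⟩ x a =
      ((G.descAct h x a).card : ℝ) / ((G.desc h x).card : ℝ) := fun a =>
    if_pos (show (⟨k, hkH⟩ : Fin H) < h from hk)
  have hp := (G.priorX_balanced_pos h k hkH x).ne'
  have hd : ((G.desc h x).card : ℝ) ≠ 0 := (Nat.cast_pos.2 (G.card_desc_pos hk h.2 x)).ne'
  simp only [Finset.sum_const, nsmul_eq_mul]
  rw [← G.desc_eq hk h.2]
  trans ∑ a, (G.desc h x).card * (G.priorX μ k hkH x / G.priorX (G.balanced h) k hkH x) *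
    μ ⟨k, hkH⟩ x a
  · refine Finset.sum_congr rfl fun a _ => ?_
    have ha : ((G.descAct h x a).card : ℝ) ≠ 0 :=
      (Nat.cast_pos.2 (G.card_descAct_pos hk h.2 x a)).ne'
    rw [← G.descAct_eq hk h.2, seqX_eq, seqX_eq, e]
    field_simp
  · rw [← Finset.mul_sum, (hμ ⟨k, hkH⟩ x).2, mul_one]

/-- The prior weight of an infoset is the sequence form at its predecessor, so the preceding
identity peels off one layer at a time until every summand is 1. -/
theorem sum_priorX_div_ancestor (G : IIEFG H S X Y A B) {μ : Strategy H X A}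
    (hμ : μ ∈ policies H X A) (h : Fin H) (k : ℕ) (hk : k < h) :
    ∑ z : X h, G.priorX μ k (hk.trans h.2) (G.ancestor hk h.2 z).1 /
        G.priorX (G.balanced h) k (hk.trans h.2) (G.ancestor hk h.2 z).1 =
      Fintype.card (X h) := by
  induction k with
  | zero => simp [priorX]
  | succ k ih =>
    rw [← ih (Nat.lt_of_succ_lt hk), ← G.sum_seqX_div_ancestor hμ h k (Nat.lt_of_succ_lt hk)]
    simp only [priorX, G.parentX_ancestor hk h.2]

theorem sum_priorX_div_balanced (G : IIEFG H S X Y A B) {μ : Strategy H X A}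
    (hμ : μ ∈ policies H X A) (h : Fin H) :
    ∑ x : X h, G.priorX μ h h.2 x / G.priorX (G.balanced h) h h.2 x = Fintype.card (X h) := by
  obtain ⟨_ | k, hh⟩ := h
  · simp [priorX]
  · rw [← G.sum_priorX_div_ancestor hμ ⟨k + 1, hh⟩ k (Nat.lt_succ_self k),
      ← G.sum_seqX_div_ancestor hμ ⟨k + 1, hh⟩ k (Nat.lt_succ_self k)]
    simp only [priorX, G.parentX_eq_ancestor hh]

/-- The balancing property of the balanced exploration policies. -/
theorem sum_seqX_div_balanced (G : IIEFG H S X Y A B) {μ : Strategy H X A}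
    (hμ : μ ∈ policies H X A) (h : Fin H) :
    ∑ x : X h, ∑ a, G.seqX μ h h.2 x a / G.seqX (G.balanced h) h h.2 x a =
      Fintype.card (X h) * Fintype.card A := by
  rw [← G.sum_priorX_div_balanced hμ h, Finset.sum_mul]
  refine Finset.sum_congr rfl fun x _ => ?_
  -- At layer `h` itself the balanced policy is uniform; its inverse is the factor |A|.
  simp only [seqX_balanced_self]
  simp only [G.seqX_eq μ]
  rw [← Finset.sum_div, ← Finset.mul_sum, (hμ h x).2, mul_one, div_div_eq_mul_div,
    mul_div_right_comm]

end IIEFG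

/-! ### Counterfactual losses and the regret decomposition -/

namespace IIEFG

variable {H : ℕ} {S X Y : ℕ → Type*} {A B : Type*} [∀ h, Fintype (S h)]

theorem seqX_congr (G : IIEFG H S X Y A B) {μ μ' : Strategy H X A} (h : ℕ) (hh : h < H)
    (e : ∀ j : Fin H, (j : ℕ) ≤ h → μ j = μ' j) (x : X h) (a : A) :
    G.seqX μ h hh x a = G.seqX μ' h hh x a := by
  induction h generalizing a with
  | zero => simp only [seqX, e ⟨0, hh⟩ le_rfl]
  | succ h ih =>
    simp only [seqX, e ⟨h + 1, hh⟩ le_rfl]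
    rw [ih _ fun j hj => e j (hj.trans h.le_succ)]

theorem priorX_congr (G : IIEFG H S X Y A B) {μ μ' : Strategy H X A} (h : ℕ) (hh : h < H)
    (e : ∀ j : Fin H, (j : ℕ) < h → μ j = μ' j) (x : X h) :
    G.priorX μ h hh x = G.priorX μ' h hh x := by
  cases h with
  | zero => rfl
  | succ h => exact G.seqX_congr _ _ (fun j hj => e j (Nat.lt_succ_of_le hj)) _ _

theorem priorX_eq_one (G : IIEFG H S X Y A B) {μ : Strategy H X A} (h : ℕ) (hh : h < H)
    (e : ∀ j : Fin H, (j : ℕ) < h → ∀ x a, μ j x a = 1) (x : X h) : G.priorX μ h hh x = 1 := by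
  induction h with
  | zero => rfl
  | succ h ih =>
    change G.seqX μ h _ _ _ = 1
    rw [seqX_eq, ih _ fun j hj => e j (hj.trans h.lt_succ_self), e _ h.lt_succ_self, one_mul]

open Classical in
/-- The strategy that plays to reach `(x, a)` at layer `h`, and `μ` afterwards: its sequence form
at the layers `k ≥ h` is supported on the descendants of `(x, a)`. -/
def continuation (μ : Strategy H X A) (h : Fin H) (x : X h) (a : A) : Strategy H X A :=
  Function.update (fun k x' a' => if k < h then 1 else μ k x' a') h
    fun x' a' => if x' = x ∧ a' = a then 1 else 0

theorem continuation_of_lt (μ : Strategy H X A) {h j : Fin H} (x : X h) (a : A) (hj : j < h)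
    (x' : X j) (a' : A) : continuation μ h x a j x' a' = 1 := by
  rw [continuation, Function.update_of_ne hj.ne]
  exact if_pos hj

theorem continuation_of_gt (μ : Strategy H X A) {h j : Fin H} (x : X h) (a : A) (hj : h < j) :
    continuation μ h x a j = μ j := by
  rw [continuation, Function.update_of_ne hj.ne']
  funext x' a'
  exact if_neg hj.not_gt

theorem continuation_congr {μ μ' : Strategy H X A} {h : Fin H} (e : ∀ j > h, μ j = μ' j)
    (x : X h) (a : A) : continuation μ h x a = continuation μ' h x a := by
  funext j
  rcases lt_trichotomy j h with hj | rfl | hj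
  · funext x' a'
    rw [continuation_of_lt _ _ _ hj, continuation_of_lt _ _ _ hj]
  · simp only [continuation, Function.update_self]
  · rw [continuation_of_gt _ _ _ hj, continuation_of_gt _ _ _ hj, e j hj]

theorem meanReward_nonneg (G : IIEFG H S X Y A B) (h : ℕ) (s : S h) (a : A) (b : B) :
    0 ≤ G.meanReward h s a b :=
  integral_nonneg fun r => r.2.1

theorem meanReward_le_one (G : IIEFG H S X Y A B) (h : ℕ) (s : S h) (a : A) (b : B) :
    G.meanReward h s a b ≤ 1 := by
  have : G.meanReward h s a b ≤ ∫ _ : I, (1 : ℝ) ∂(G.reward h s a b : Measure I) :=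
    integral_mono_of_nonneg (Filter.Eventually.of_forall fun r => r.2.1) (integrable_const 1)
      (Filter.Eventually.of_forall fun r => r.2.2)
  simpa using this

-- Restricting to the paths through (x, a) amounts to deleting the other entries of the strategy at
-- layer `h`. The result is no policy, but it stays normalized after `h`, which is all that
-- `sum_pathProb_mul` requires.
open Classical in
theorem pathProb_restrict (G : IIEFG H S X Y A B) (ρ : Strategy H X A) (ν : Strategy H Y B)
    (h : Fin H) (x : X h) (a : A) (τ : GamePath H S A B) :
    G.pathProb (Function.update ρ h fun x' a' => if x' = x ∧ a' = a then ρ h x' a' else 0) ν τ =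
      if G.infoX h (τ h).1 = x ∧ (τ h).2.1 = a then G.pathProb ρ ν τ else 0 := by
  split_ifs with hc
  · unfold pathProb
    congr 1
    refine Finset.prod_congr rfl fun j _ => ?_
    congr 2
    rcases eq_or_ne j h with rfl | hj
    · rw [Function.update_self, if_pos hc]
    · rw [Function.update_of_ne hj]
  · unfold pathProb
    rw [Finset.prod_eq_zero (Finset.mem_univ h), mul_zero]
    rw [Function.update_self, if_neg hc, zero_mul, zero_mul]

open Classical in
/-- The contribution of nature and of the min-player to the probability of reaching `x`. -/
def visitProb (G : IIEFG H S X Y A B) (ν : Strategy H Y B) (h : Fin H) (x : X h) : ℝ :=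
  ∑ s : S h with G.infoX h s = x, G.transSeq h h.2 s * G.priorY ν h h.2 (G.infoY h s)

section

variable [Fintype A] [Fintype B]

theorem sum_seqX_mul_seqY (G : IIEFG H S X Y A B) {μ : Strategy H X A} {ν : Strategy H Y B}
    (hμ : μ ∈ policies H X A) (hν : ν ∈ policies H Y B) (k : Fin H) :
    ∑ q : S k × A × B, G.transSeq k k.2 q.1 *
      (G.seqX μ k k.2 (G.infoX k q.1) q.2.1 * G.seqY ν k k.2 (G.infoY k q.1) q.2.2) = 1 := by
  rw [← G.sum_transSeq_mul_prior hμ hν k k.2, Fintype.sum_prod_type]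
  refine Finset.sum_congr rfl fun s _ => ?_
  have e : (∑ a, μ k (G.infoX k s) a) * ∑ b, ν k (G.infoY k s) b = 1 := by
    rw [(hμ k _).2, (hν k _).2, mul_one]
  rw [← mul_one (G.transSeq k k.2 s * (G.priorX μ k k.2 (G.infoX k s) *
    G.priorY ν k k.2 (G.infoY k s))), ← e, Finset.sum_mul_sum, Finset.mul_sum,
    Fintype.sum_prod_type]
  refine Finset.sum_congr rfl fun a _ => ?_
  rw [Finset.mul_sum]
  refine Finset.sum_congr rfl fun b _ => ?_
  rw [seqX_eq, seqY_eq]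
  ring

open Classical in
theorem sum_pathProb_visit (G : IIEFG H S X Y A B) {ρ : Strategy H X A} {ν : Strategy H Y B}
    (hρ : ρ ∈ policies H X A) (hν : ν ∈ policies H Y B) (h : Fin H) (x : X h) (a : A) :
    ∑ τ, (if G.infoX h (τ h).1 = x ∧ (τ h).2.1 = a then G.pathProb ρ ν τ else 0) =
      G.seqX ρ h h.2 x a * G.visitProb ν h x := by
  have e := G.sum_pathProb_mul ρ ν h (fun j _ z => (hρ j z).2) (fun j _ z => (hν j z).2)
    fun q => if G.infoX h q.1 = x ∧ q.2.1 = a then 1 else 0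
  simp only [mul_ite, mul_one, mul_zero] at e
  rw [e, Fintype.sum_prod_type, visitProb, Finset.mul_sum, Finset.sum_filter]
  refine Finset.sum_congr rfl fun s _ => ?_
  rw [Fintype.sum_prod_type]
  by_cases hs : G.infoX h s = x
  · simp only [hs, true_and, if_true]
    rw [Finset.sum_eq_single a (fun a' _ ha => Finset.sum_eq_zero fun b _ => if_neg ha) (by simp)]
    simp only [if_true, seqY_eq]
    simp_rw [← Finset.mul_sum]
    rw [(hν h _).2]
    ring
  · simp [hs]

end

variable [∀ h, Fintype (X h)] [Fintype A]

/-- The sequence form factors at the pair of layer `h` on the history of `z`; the continuations of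
all other pairs vanish at `z`. -/
theorem seqX_eq_sum_continuation (G : IIEFG H S X Y A B) (μ : Strategy H X A) (h : Fin H) (k : ℕ)
    (hk : h ≤ k) (hkH : k < H) (z : X k) (c : A) :
    G.seqX μ k hkH z c = ∑ x : X h, ∑ a, G.seqX μ h h.2 x a *
      G.seqX (continuation μ h x a) k hkH z c := by
  classical
  induction k, hk using Nat.le_induction generalizing c with
  | base =>
    have e : ∀ x a, G.seqX (continuation μ h x a) h h.2 z c = if z = x ∧ c = a then 1 else 0 := by
      intro x a
      rw [seqX_eq, G.priorX_eq_one h h.2 (fun j hj => continuation_of_lt μ x a hj), one_mul]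
      simp only [continuation, Fin.eta, Function.update_self]
    simp only [e, mul_ite, mul_one, mul_zero]
    rw [Finset.sum_eq_single z, Finset.sum_eq_single c]
    · simp
    · intro a _ ha
      rw [if_neg fun e => ha e.2.symm]
    · simp
    · intro x _ hx
      exact Finset.sum_eq_zero fun a _ => if_neg fun e => hx e.1.symm
    · simp
  | succ k hk ih =>
    simp only [seqX]
    rw [ih, Finset.sum_mul]
    refine Finset.sum_congr rfl fun x _ => ?_
    rw [Finset.sum_mul]
    refine Finset.sum_congr rfl fun a _ => ?_
    rw [continuation_of_gt μ x a (show h < ⟨k + 1, hkH⟩ from Nat.lt_succ_of_le hk), mul_assoc]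

/-- The counterfactual loss of `(x, a)` when `μ` is played after layer `h`. -/
def contLoss (G : IIEFG H S X Y A B) (μ : Strategy H X A) (ℓ : ∀ h : Fin H, X h → A → ℝ)
    (h : Fin H) (x : X h) (a : A) : ℝ :=
  ∑ k : Fin H with h ≤ k, ∑ z : X k, ∑ c,
    G.seqX (continuation μ h x a) k k.2 z c * ℓ k z c

theorem contLoss_congr (G : IIEFG H S X Y A B) {μ μ' : Strategy H X A}
    (ℓ : ∀ h : Fin H, X h → A → ℝ) {h : Fin H} (e : ∀ j > h, μ j = μ' j) (x : X h) (a : A) :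
    G.contLoss μ ℓ h x a = G.contLoss μ' ℓ h x a := by
  simp only [contLoss, continuation_congr e]

theorem sum_seqX_mul_contLoss (G : IIEFG H S X Y A B) (μ : Strategy H X A)
    (ℓ : ∀ h : Fin H, X h → A → ℝ) (h : Fin H) :
    ∑ k : Fin H with h ≤ k, ∑ z : X k, ∑ c, G.seqX μ k k.2 z c * ℓ k z c =
      ∑ x : X h, ∑ a, G.seqX μ h h.2 x a * G.contLoss μ ℓ h x a := by
  have e : ∀ k ∈ Finset.univ.filter (fun k : Fin H => h ≤ k), ∀ z : X k, ∀ c,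
      G.seqX μ k k.2 z c * ℓ k z c = ∑ x : X h, ∑ a, G.seqX μ h h.2 x a *
        (G.seqX (continuation μ h x a) k k.2 z c * ℓ k z c) := by
    intro k hk z c
    rw [G.seqX_eq_sum_continuation μ h k (Finset.mem_filter.1 hk).2, Finset.sum_mul]
    refine Finset.sum_congr rfl fun x _ => ?_
    rw [Finset.sum_mul]
    exact Finset.sum_congr rfl fun a _ => mul_assoc _ _ _
  calc _ = ∑ k : Fin H with h ≤ k, ∑ z : X k, ∑ c, ∑ x : X h, ∑ a, G.seqX μ h h.2 x a *
        (G.seqX (continuation μ h x a) k k.2 z c * ℓ k z c) :=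
        Finset.sum_congr rfl fun k hk => Finset.sum_congr rfl fun z _ =>
          Finset.sum_congr rfl fun c _ => e k hk z c
    _ = ∑ k : Fin H with h ≤ k, ∑ x : X h, ∑ a, G.seqX μ h h.2 x a *
        ∑ z : X k, ∑ c, G.seqX (continuation μ h x a) k k.2 z c * ℓ k z c := by
        refine Finset.sum_congr rfl fun k _ => ?_
        simp only [Finset.mul_sum]
        rw [Finset.sum_congr rfl fun z _ => Finset.sum_comm, Finset.sum_comm]
        refine Finset.sum_congr rfl fun x _ => ?_
        rw [Finset.sum_congr rfl fun z _ => Finset.sum_comm, Finset.sum_comm]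
    _ = _ := by
        rw [Finset.sum_comm]
        refine Finset.sum_congr rfl fun x _ => ?_
        rw [Finset.sum_comm]
        refine Finset.sum_congr rfl fun a _ => ?_
        rw [contLoss, Finset.mul_sum]

/-- Decomposition of the regret into the immediate counterfactual regrets. -/
theorem pairing_sub_pairing (G : IIEFG H S X Y A B) (μ μ' : Strategy H X A)
    (ℓ : ∀ h : Fin H, X h → A → ℝ) :
    G.pairing μ ℓ - G.pairing μ' ℓ = ∑ h : Fin H, ∑ x : X h, G.priorX μ' h h.2 x *
      ∑ a, (μ h x a - μ' h x a) * G.contLoss μ ℓ h x a := by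
  -- Hybrid strategies: the comparator in the layers below n and `μ` from n on. The regret
  -- telescopes over n.
  let ρ : ℕ → Strategy H X A := fun n k => if (k : ℕ) < n then μ' k else μ k
  have h0 : ρ 0 = μ := by funext k; exact if_neg (Nat.not_lt_zero _)
  have hH : ρ H = μ' := by funext k; exact if_pos k.2
  rw [← h0, ← hH, ← Finset.sum_range_sub' (fun n => G.pairing (ρ n) ℓ), Finset.sum_range, h0, hH]
  refine Finset.sum_congr rfl fun h _ => ?_
  have hlt : ∀ j : Fin H, j < h → ρ h j = μ' j := fun j hj => if_pos hj
  have hlt' : ∀ j : Fin H, j ≤ h → ρ (h + 1) j = μ' j := fun j hj => if_pos (Nat.lt_succ_of_le hj)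
  have hge : ∀ j : Fin H, h ≤ j → ρ h j = μ j := fun j hj => if_neg (not_lt.2 hj)
  have hgt : ∀ j : Fin H, j > h → ρ (h + 1) j = μ j := fun j hj =>
    if_neg (not_lt.2 (Nat.succ_le_of_lt hj))
  -- Consecutive hybrids differ at layer `h` only, so the losses of earlier layers cancel.
  have hlow : ∑ k : Fin H with ¬ h ≤ k, ∑ z : X k, ∑ c, G.seqX (ρ h) k k.2 z c * ℓ k z c =
      ∑ k : Fin H with ¬ h ≤ k, ∑ z : X k, ∑ c, G.seqX (ρ (h + 1)) k k.2 z c * ℓ k z c := by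
    refine Finset.sum_congr rfl fun k hk => Finset.sum_congr rfl fun z _ =>
      Finset.sum_congr rfl fun c _ => ?_
    have hk' := not_le.1 (Finset.mem_filter.1 hk).2
    rw [G.seqX_congr k k.2 fun j hj => ?_]
    have hj' : j < h := lt_of_le_of_lt (show j ≤ k from hj) hk'
    rw [hlt j hj', hlt' j hj'.le]
  unfold pairing
  rw [← Finset.sum_filter_add_sum_filter_not Finset.univ (fun k => h ≤ k)
      fun k : Fin H => ∑ z : X k, ∑ c, G.seqX (ρ h) k k.2 z c * ℓ k z c,
    ← Finset.sum_filter_add_sum_filter_not Finset.univ (fun k => h ≤ k)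
      fun k : Fin H => ∑ z : X k, ∑ c, G.seqX (ρ (h + 1)) k k.2 z c * ℓ k z c,
    hlow, add_sub_add_right_eq_sub, sum_seqX_mul_contLoss, sum_seqX_mul_contLoss,
    ← Finset.sum_sub_distrib]
  refine Finset.sum_congr rfl fun x _ => ?_
  rw [← Finset.sum_sub_distrib, Finset.mul_sum]
  refine Finset.sum_congr rfl fun a _ => ?_
  -- Both hybrids play `μ` after `h`, hence share its counterfactual loss; both play the comparator
  -- before `h`, hence share its prior weight.
  rw [G.contLoss_congr ℓ (fun j hj => hge j hj.le), G.contLoss_congr ℓ hgt, seqX_eq, seqX_eq,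
    hge h le_rfl, hlt' h le_rfl,
    G.priorX_congr h h.2 (fun j hj => hlt j hj),
    G.priorX_congr (μ := ρ (h + 1)) h h.2 (fun j hj => hlt' j (le_of_lt hj))]
  ring

variable [Fintype B]

theorem sum_seqX_mul_loss (G : IIEFG H S X Y A B) (ρ : Strategy H X A) (ν : Strategy H Y B)
    (k : Fin H) :
    ∑ z : X k, ∑ a, G.seqX ρ k k.2 z a * G.loss ν k z a =
      ∑ q : S k × A × B, G.transSeq k k.2 q.1 *
        (G.seqX ρ k k.2 (G.infoX k q.1) q.2.1 * G.seqY ν k k.2 (G.infoY k q.1) q.2.2) *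
          (1 - G.meanReward k q.1 q.2.1 q.2.2) := by
  classical
  rw [Fintype.sum_prod_type, ← Finset.sum_fiberwise Finset.univ fun s => G.infoX k s]
  refine Finset.sum_congr rfl fun z _ => ?_
  simp only [Fintype.sum_prod_type]
  rw [Finset.sum_comm]
  refine Finset.sum_congr rfl fun a _ => ?_
  rw [loss, Finset.mul_sum]
  refine Finset.sum_congr (by congr) fun s hs => ?_
  rw [Finset.mul_sum]
  refine Finset.sum_congr rfl fun b _ => ?_
  rw [(Finset.mem_filter.1 hs).2]
  ring

theorem pairing_loss_nonneg (G : IIEFG H S X Y A B) {μ : Strategy H X A} {ν : Strategy H Y B}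
    (hμ : μ ∈ policies H X A) (hν : ν ∈ policies H Y B) : 0 ≤ G.pairing μ (G.loss ν) := by
  refine Finset.sum_nonneg fun k _ => ?_
  rw [sum_seqX_mul_loss]
  refine Finset.sum_nonneg fun q _ => mul_nonneg (mul_nonneg (G.transSeq_nonneg _ _ _)
    (mul_nonneg (G.seqX_nonneg (fun h x a => (hμ h x).1 a) _ _ _ _)
      (G.seqY_nonneg (fun h y b => (hν h y).1 b) _ _ _ _))) ?_
  linarith [G.meanReward_le_one k q.1 q.2.1 q.2.2]

theorem pairing_loss_le (G : IIEFG H S X Y A B) {μ : Strategy H X A} {ν : Strategy H Y B}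
    (hμ : μ ∈ policies H X A) (hν : ν ∈ policies H Y B) : G.pairing μ (G.loss ν) ≤ H := by
  have h1 : ∀ k : Fin H, ∑ z : X k, ∑ a, G.seqX μ k k.2 z a * G.loss ν k z a ≤ 1 := by
    intro k
    rw [sum_seqX_mul_loss]
    refine (Finset.sum_le_sum fun q _ => mul_le_of_le_one_right (mul_nonneg
      (G.transSeq_nonneg _ _ _) (mul_nonneg (G.seqX_nonneg (fun h x a => (hμ h x).1 a) _ _ _ _)
        (G.seqY_nonneg (fun h y b => (hν h y).1 b) _ _ _ _))) ?_).trans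
          (G.sum_seqX_mul_seqY hμ hν k).le
    linarith [G.meanReward_nonneg k q.1 q.2.1 q.2.2]
  exact (Finset.sum_le_sum fun k _ => h1 k).trans (by simp)

/-- An episode meets exactly one infoset per layer. Since this holds for every policy, the
second-order terms can be summed against an arbitrary comparator. -/
theorem sum_priorX_mul_visitProb (G : IIEFG H S X Y A B) {μ : Strategy H X A}
    {ν : Strategy H Y B} (hμ : μ ∈ policies H X A) (hν : ν ∈ policies H Y B) (h : Fin H) :
    ∑ x : X h, G.priorX μ h h.2 x * G.visitProb ν h x = 1 := by
  classical
  rw [← G.sum_transSeq_mul_prior hμ hν h h.2,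
    ← Finset.sum_fiberwise Finset.univ fun s => G.infoX h s]
  refine Finset.sum_congr rfl fun x _ => ?_
  rw [visitProb, Finset.mul_sum]
  refine Finset.sum_congr (by congr) fun s hs => ?_
  rw [(Finset.mem_filter.1 hs).2]
  ring

-- The strategy restricted to (x, a) at layer `h` has sequence form at layer `k` equal to the reach
-- weight of (x, a) times that of the continuation. Its layer-`k` marginal is therefore the
-- counterfactual loss with the reach weight pulled out.
open Classical in
theorem sum_pathProb_visit_mul (G : IIEFG H S X Y A B) {ρ : Strategy H X A} {ν : Strategy H Y B}
    (hρ : ρ ∈ policies H X A) (hν : ν ∈ policies H Y B) (h k : Fin H) (hk : h ≤ k) (x : X h)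
    (a : A) :
    ∑ τ, (if G.infoX h (τ h).1 = x ∧ (τ h).2.1 = a then G.pathProb ρ ν τ else 0) *
        (1 - G.meanReward k (τ k).1 (τ k).2.1 (τ k).2.2) =
      G.seqX ρ h h.2 x a *
        ∑ z : X k, ∑ c, G.seqX (continuation ρ h x a) k k.2 z c * G.loss ν k z c := by
  set ρ' : Strategy H X A :=
    Function.update ρ h fun x' a' => if x' = x ∧ a' = a then ρ h x' a' else 0 with hρ'
  have hne : ∀ j, j ≠ h → ρ' j = ρ j := fun j hj => Function.update_of_ne hj _ _
  have hseq : ∀ x' a', G.seqX ρ' h h.2 x' a' =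
      if x' = x ∧ a' = a then G.seqX ρ h h.2 x a else 0 := by
    intro x' a'
    have e : ρ' h x' a' = if x' = x ∧ a' = a then ρ h x' a' else 0 := by
      rw [hρ', Function.update_self]
    rw [seqX_eq, G.priorX_congr (μ' := ρ) h h.2
      fun j hj => hne j (ne_of_lt (show j < h from hj))]
    change _ * ρ' h x' a' = _
    rw [e]
    split_ifs with hc
    · rw [hc.1, hc.2, seqX_eq]
    · rw [mul_zero]
  have hseqk : ∀ z c, G.seqX ρ' k k.2 z c =
      G.seqX ρ h h.2 x a * G.seqX (continuation ρ h x a) k k.2 z c := by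
    intro z c
    rw [G.seqX_eq_sum_continuation ρ' h k hk, Finset.sum_eq_single x, Finset.sum_eq_single a]
    · rw [hseq, if_pos ⟨rfl, rfl⟩, continuation_congr fun j hj => hne j (ne_of_gt hj)]
    · intro a' _ ha
      rw [hseq, if_neg fun e => ha e.2, zero_mul]
    · simp
    · intro x' _ hx
      exact Finset.sum_eq_zero fun a' _ => by rw [hseq, if_neg fun e => hx e.1, zero_mul]
    · simp
  simp_rw [← G.pathProb_restrict ρ ν h x a, ← hρ']
  rw [G.sum_pathProb_mul ρ' ν k
    (fun j hj z => by rw [hne j (ne_of_gt (lt_of_le_of_lt hk hj))]; exact (hρ j z).2)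
    (fun j _ z => (hν j z).2) fun q => 1 - G.meanReward k q.1 q.2.1 q.2.2,
    ← sum_seqX_mul_loss]
  simp only [hseqk, mul_assoc, Finset.mul_sum]

end IIEFG

/-! ### Exponential deviation inequalities -/

/-- The exponential is a supermartingale: given `𝒢 t`, its next factor has mean at most e^(-d)(1 +
d) ≤ 1. Measurability and the crude almost sure bound are carried through the induction to make the
products integrable. -/
theorem integral_exp_sum_sub_le {Ω : Type*} {m : MeasurableSpace Ω} {P : Measure Ω}
    [IsProbabilityMeasure P] {𝒢 : ℕ → MeasurableSpace Ω} (hmono : Monotone 𝒢) (hle : ∀ t, 𝒢 t ≤ m)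
    {W K d : ℕ → Ω → ℝ} {c : ℝ} {T : ℕ}
    (hW : ∀ t < T, Measurable[𝒢 (t + 1)] (W t)) (hK : ∀ t < T, Measurable (K t))
    (hd : ∀ t < T, Measurable[𝒢 t] (d t)) (hWK : ∀ t < T, ∀ ω, Real.exp (W t ω) ≤ 1 + K t ω)
    (hKc : ∀ t < T, ∀ ω, |K t ω| ≤ c) (hKd : ∀ t < T, P[K t | 𝒢 t] =ᵐ[P] d t) (n : ℕ)
    (hn : n ≤ T) :
    Measurable[𝒢 n] (fun ω => Real.exp (∑ t ∈ Finset.range n, (W t ω - d t ω))) ∧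
      (∀ᵐ ω ∂P, Real.exp (∑ t ∈ Finset.range n, (W t ω - d t ω)) ≤
        ((1 + c) * Real.exp c) ^ n) ∧
      ∫ ω, Real.exp (∑ t ∈ Finset.range n, (W t ω - d t ω)) ∂P ≤ 1 := by
  induction n with
  | zero => simp
  | succ n ih =>
    obtain ⟨hm, hb, hi⟩ := ih (Nat.le_of_succ_le hn)
    have hnT : n < T := hn
    set g : Ω → ℝ := fun ω => Real.exp (∑ t ∈ Finset.range n, (W t ω - d t ω)) with hg
    have hg0 : ∀ ω, 0 ≤ g ω := fun ω => (Real.exp_pos _).le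
    have hdn : Measurable[𝒢 n] fun ω => Real.exp (-d n ω) :=
      Real.measurable_exp.comp (hd n hnT).neg
    have hsucc : ∀ ω, Real.exp (∑ t ∈ Finset.range (n + 1), (W t ω - d t ω)) =
        g ω * Real.exp (-d n ω) * Real.exp (W n ω) := by
      intro ω
      rw [Finset.sum_range_succ, Real.exp_add, sub_eq_neg_add, Real.exp_add, ← mul_assoc]
    have hms : Measurable[𝒢 (n + 1)]
        fun ω => Real.exp (∑ t ∈ Finset.range (n + 1), (W t ω - d t ω)) := by
      simp_rw [hsucc]
      exact ((hm.mono (hmono n.le_succ) le_rfl).mul (hdn.mono (hmono n.le_succ) le_rfl)).mul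
        (Real.measurable_exp.comp (hW n hnT))
    have hdb : ∀ᵐ ω ∂P, |d n ω| ≤ c := by
      filter_upwards [hKd n hnT, ae_bdd_abs_condExp_of_ae_bdd_abs (m := 𝒢 n) (μ := P)
        (Filter.Eventually.of_forall (hKc n hnT))] with ω h1 h2
      rwa [← h1]
    have hgd : ∀ᵐ ω ∂P, ‖g ω * Real.exp (-d n ω)‖ ≤
        ((1 + c) * Real.exp c) ^ n * Real.exp c := by
      filter_upwards [hb, hdb] with ω h1 h2
      rw [Real.norm_of_nonneg (mul_nonneg (hg0 ω) (Real.exp_pos _).le)]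
      exact mul_le_mul h1 (Real.exp_le_exp.2 (by linarith [neg_abs_le (d n ω)]))
        (Real.exp_pos _).le ((hg0 ω).trans h1)
    have hKi : Integrable (fun ω => 1 + K n ω) P :=
      (integrable_const 1).add (Integrable.of_bound (hK n hnT).aestronglyMeasurable c
        (Filter.Eventually.of_forall (hKc n hnT)))
    have hgm : StronglyMeasurable[𝒢 n] fun ω => g ω * Real.exp (-d n ω) :=
      (hm.mul hdn).stronglyMeasurable
    have hbs : ∀ᵐ ω ∂P, Real.exp (∑ t ∈ Finset.range (n + 1), (W t ω - d t ω)) ≤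
        ((1 + c) * Real.exp c) ^ (n + 1) := by
      filter_upwards [hgd] with ω h1
      have h2 := (le_abs_self _).trans h1
      rw [hsucc, pow_succ]
      calc _ ≤ ((1 + c) * Real.exp c) ^ n * Real.exp c * (1 + c) :=
            mul_le_mul h2 ((hWK n hnT ω).trans (by linarith [(le_abs_self _).trans (hKc n hnT ω)]))
              (Real.exp_pos _).le ((norm_nonneg _).trans h1)
        _ = _ := by ring
    refine ⟨hms, hbs, le_trans ?_ hi⟩
    have hce := condExp_stronglyMeasurable_mul_of_bound (hle n) hgm hKi _ hgd
    have hgKi : Integrable ((fun ω => g ω * Real.exp (-d n ω)) * fun ω => 1 + K n ω) P :=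
      hKi.bdd_mul (hgm.mono (hle n)).aestronglyMeasurable hgd
    have hone : P[fun ω => 1 + K n ω | 𝒢 n] =ᵐ[P] fun ω => 1 + d n ω := by
      have h1 := condExp_add (μ := P) (integrable_const (1 : ℝ))
        (Integrable.of_bound (hK n hnT).aestronglyMeasurable c
          (Filter.Eventually.of_forall (hKc n hnT))) (𝒢 n)
      rw [condExp_const (hle n)] at h1
      filter_upwards [h1, hKd n hnT] with ω h2 h3
      rw [← h3]
      exact h2
    calc _ ≤ ∫ ω, ((fun ω => g ω * Real.exp (-d n ω)) * fun ω => 1 + K n ω) ω ∂P := by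
          refine integral_mono_of_nonneg (Filter.Eventually.of_forall fun ω => (Real.exp_pos _).le)
            hgKi (Filter.Eventually.of_forall fun ω => ?_)
          simp only [hsucc, Pi.mul_apply]
          exact mul_le_mul_of_nonneg_left (hWK n hnT ω) (mul_nonneg (hg0 ω) (Real.exp_pos _).le)
      _ = ∫ ω, (P[(fun ω => g ω * Real.exp (-d n ω)) * fun ω => 1 + K n ω | 𝒢 n]) ω ∂P :=
          (integral_condExp (hle n)).symm
      _ ≤ ∫ ω, g ω ∂P := by
          have hgi : Integrable g P := Integrable.of_bound
            (hm.mono (hle n) le_rfl).aestronglyMeasurable (((1 + c) * Real.exp c) ^ n)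
            (hb.mono fun ω h => by rwa [Real.norm_of_nonneg (hg0 ω)])
          refine integral_mono_ae integrable_condExp hgi ?_
          · filter_upwards [hce, hone] with ω h1 h2
            rw [h1, Pi.mul_apply, h2, mul_assoc]
            refine mul_le_of_le_one_right (hg0 ω) ?_
            rw [Real.exp_neg, inv_mul_le_iff₀ (Real.exp_pos _), mul_one]
            linarith [Real.add_one_le_exp (d n ω)]

/-- Exponential Markov inequality for a sequence of increments whose conditional exponential
moments are controlled. -/
theorem measure_le_sum_sub_le {Ω : Type*} {m : MeasurableSpace Ω} {P : Measure Ω}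
    [IsProbabilityMeasure P] {𝒢 : ℕ → MeasurableSpace Ω} (hmono : Monotone 𝒢) (hle : ∀ t, 𝒢 t ≤ m)
    {W K d : ℕ → Ω → ℝ} {c : ℝ} {T : ℕ}
    (hW : ∀ t < T, Measurable[𝒢 (t + 1)] (W t)) (hK : ∀ t < T, Measurable (K t))
    (hWK : ∀ t < T, ∀ ω, Real.exp (W t ω) ≤ 1 + K t ω)
    (hKc : ∀ t < T, ∀ ω, |K t ω| ≤ c) (hKd : ∀ t < T, P[K t | 𝒢 t] =ᵐ[P] d t) (ε : ℝ) :
    P {ω | ε ≤ ∑ t ∈ Finset.range T, (W t ω - d t ω)} ≤ ENNReal.ofReal (Real.exp (-ε)) := by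
  -- The compensator is the conditional expectation itself, measurable for free. The given `d` is
  -- substituted afterwards, almost everywhere, so it needs no measurability of its own.
  obtain ⟨hm, hb, hi⟩ := integral_exp_sum_sub_le (P := P) (d := fun t => P[K t | 𝒢 t]) hmono hle
    hW hK (fun t _ => stronglyMeasurable_condExp.measurable) hWK hKc
    (fun t _ => Filter.EventuallyEq.rfl) T le_rfl
  have hint : Integrable
      (fun ω => Real.exp (∑ t ∈ Finset.range T, (W t ω - (P[K t | 𝒢 t]) ω))) P :=
    Integrable.of_bound (hm.mono (hle T) le_rfl).aestronglyMeasurable _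
      (hb.mono fun ω h => by rwa [Real.norm_of_nonneg (Real.exp_pos _).le])
  have key := mul_meas_ge_le_integral_of_nonneg
    (Filter.Eventually.of_forall fun ω => (Real.exp_pos _).le) hint (Real.exp ε)
  simp only [Real.exp_le_exp] at key
  have hae : ∀ᵐ ω ∂P, ∀ t ∈ Finset.range T, (P[K t | 𝒢 t]) ω = d t ω :=
    (Finset.eventually_all (Finset.range T)).2 fun t ht => hKd t (Finset.mem_range.1 ht)
  have hset : P {ω | ε ≤ ∑ t ∈ Finset.range T, (W t ω - d t ω)} =
      P {ω | ε ≤ ∑ t ∈ Finset.range T, (W t ω - (P[K t | 𝒢 t]) ω)} := by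
    refine measure_congr ?_
    filter_upwards [hae] with ω h
    refine propext ?_
    change ε ≤ ∑ t ∈ Finset.range T, (W t ω - d t ω) ↔
      ε ≤ ∑ t ∈ Finset.range T, (W t ω - (P[K t | 𝒢 t]) ω)
    have e : ∑ t ∈ Finset.range T, (W t ω - (P[K t | 𝒢 t]) ω) =
        ∑ t ∈ Finset.range T, (W t ω - d t ω) :=
      Finset.sum_congr rfl fun t ht => by rw [h t ht]
    rw [e]
  rw [hset, ← ofReal_measureReal]
  refine ENNReal.ofReal_le_ofReal ?_
  rw [Real.exp_neg, ← mul_one (Real.exp ε)⁻¹, ← div_eq_inv_mul, le_div_iff₀' (Real.exp_pos _)]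
  exact key.trans hi

/-- A conditional product law of a finitely valued and a general random variable integrates
functions of the latter. -/
theorem condExp_indicator_comp {Ω R : Type*} {𝒢 m : MeasurableSpace Ω} [MeasurableSpace R]
    {P : Measure Ω} [IsProbabilityMeasure P] (hle : 𝒢 ≤ m) {D : Set Ω}
    (hD : MeasurableSet D) {ξ : Ω → R} (hξ : Measurable ξ) {p : Ω → ℝ} {ρ : Measure R}
    [IsProbabilityMeasure ρ]
    (h : ∀ E, MeasurableSet E → P⟦D ∩ ξ ⁻¹' E | 𝒢⟧ =ᵐ[P] fun ω => p ω * ρ.real E)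
    {φ : R → ℝ} (hφ : Measurable φ) {c : ℝ} (hc : ∀ r, |φ r| ≤ c) :
    P[D.indicator fun ω => φ (ξ ω) | 𝒢] =ᵐ[P] fun ω => p ω * ∫ r, φ r ∂ρ := by
  have hp : P⟦D | 𝒢⟧ =ᵐ[P] p := by simpa using h Set.univ MeasurableSet.univ
  have hpi : Integrable p P := integrable_condExp.congr hp
  have hp0 : 0 ≤ᵐ[P] p := by
    have h1 : 0 ≤ᵐ[P] P⟦D | 𝒢⟧ :=
      condExp_nonneg (Filter.Eventually.of_forall (Set.indicator_nonneg fun _ _ => zero_le_one))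
    filter_upwards [h1, hp] with ω h1 h2
    rwa [← h2]
  have hφξ : Integrable (fun ω => φ (ξ ω)) P :=
    Integrable.of_bound (hφ.comp hξ).aestronglyMeasurable c
      (Filter.Eventually.of_forall fun ω => hc (ξ ω))
  have hφi : Integrable (D.indicator fun ω => φ (ξ ω)) P := hφξ.indicator hD
  refine (ae_eq_condExp_of_forall_setIntegral_eq hle hφi (fun s _ _ =>
    (hpi.mul_const _).integrableOn) (fun s hs _ => ?_) ?_).symm
  · have hs' := hle s hs
    -- On s ∩ D the law of `ξ` is a multiple of `ρ`, so indicators suffice to know the integral of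
    -- every bounded `φ`.
    have hmap : ((P.restrict s).restrict D).map ξ =
        ENNReal.ofReal (∫ ω in s, p ω ∂P) • ρ := by
      refine Measure.ext fun E hE => ?_
      have e1 : ∫ ω in s, (P⟦D ∩ ξ ⁻¹' E | 𝒢⟧) ω ∂P = (∫ ω in s, p ω ∂P) * ρ.real E := by
        rw [setIntegral_congr_ae hs' ((h E hE).mono fun ω e _ => e), integral_mul_const]
      have hDE : MeasurableSet (D ∩ ξ ⁻¹' E) := hD.inter (hξ hE)
      rw [setIntegral_condExp hle ((integrable_const (1 : ℝ)).indicator hDE) hs,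
        setIntegral_indicator hDE, setIntegral_const, smul_eq_mul, mul_one] at e1
      rw [Measure.map_apply hξ hE, Measure.restrict_apply (hξ hE),
        Measure.restrict_apply ((hξ hE).inter hD), Measure.smul_apply, smul_eq_mul,
        ← ofReal_measureReal (μ := ρ), ← ENNReal.ofReal_mul
          (integral_nonneg_of_ae (ae_restrict_of_ae hp0)), ← e1, ofReal_measureReal]
      congr 1
      ext ω
      simp only [Set.mem_inter_iff, Set.mem_preimage]
      tauto
    rw [integral_mul_const, integral_indicator hD, ← integral_map (f := φ) hξ.aemeasurable
      hφ.aestronglyMeasurable, hmap, integral_smul_measure, smul_eq_mul, ENNReal.toReal_ofReal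
      (integral_nonneg_of_ae (ae_restrict_of_ae hp0))]
  · exact ((stronglyMeasurable_condExp.aestronglyMeasurable).congr hp).mul_const _

/-- Phrased through fibres because the finite space of game paths carries no σ-algebra. -/
theorem measurable_comp_of_fibers {Ω α β : Type*} [MeasurableSpace Ω] [Finite α]
    [MeasurableSpace β] {g : Ω → α} (hg : ∀ a, MeasurableSet {ω | g ω = a}) (f : α → β) :
    Measurable fun ω => f (g ω) := by
  intro s _
  have e : (fun ω => f (g ω)) ⁻¹' s = ⋃ a ∈ f ⁻¹' s, {ω | g ω = a} := by
    ext ω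
    simp
  rw [e]
  exact MeasurableSet.biUnion (Set.to_countable _) fun a _ => hg a

/-! ### Observed losses, the Hedge potential and conditional means -/

namespace IIEFG

variable {H : ℕ} {S X Y : ℕ → Type*} {A B : Type*} [∀ h, Fintype (S h)]

/-- The total loss from layer `h` on. -/
def tailLoss (h : Fin H) (r : Fin H → I) : ℝ :=
  ∑ k : Fin H with h ≤ k, (1 - (r k : ℝ))

theorem tailLoss_eq (h : Fin H) (r : Fin H → I) :
    tailLoss h r = (H : ℝ) - (h : ℝ) - ∑ k : Fin H with h ≤ k, (r k : ℝ) := by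
  have e : (Finset.univ.filter fun k : Fin H => h ≤ k).card = H - h := by
    rw [show (Finset.univ.filter fun k : Fin H => h ≤ k) = Finset.Ici h by ext; simp, Fin.card_Ici]
  rw [tailLoss, Finset.sum_sub_distrib, Finset.sum_const, e, nsmul_eq_mul, mul_one,
    Nat.cast_sub h.2.le]

theorem tailLoss_nonneg (h : Fin H) (r : Fin H → I) : 0 ≤ tailLoss h r :=
  Finset.sum_nonneg fun k _ => sub_nonneg.2 (r k).2.2

theorem tailLoss_le (h : Fin H) (r : Fin H → I) : tailLoss h r ≤ H := by
  rw [tailLoss_eq]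
  have h1 : (0 : ℝ) ≤ ∑ k : Fin H with h ≤ k, (r k : ℝ) := Finset.sum_nonneg fun k _ => (r k).2.1
  have h2 : (0 : ℝ) ≤ (h : ℕ) := Nat.cast_nonneg _
  linarith

theorem measurable_tailLoss (h : Fin H) : Measurable (tailLoss h) :=
  Finset.measurable_fun_sum _ fun k _ =>
    measurable_const.sub (measurable_subtype_coe.comp (measurable_pi_apply k))

open Classical in
/-- The total loss from layer `h` on if the episode passes through `(x, a)`, and zero otherwise. -/
def visitLoss (G : IIEFG H S X Y A B) (h : Fin H) (x : X h) (a : A) (τ : GamePath H S A B)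
    (r : Fin H → I) : ℝ :=
  if G.infoX h (τ h).1 = x ∧ (τ h).2.1 = a then tailLoss h r else 0

theorem integral_tailLoss (G : IIEFG H S X Y A B) (h : Fin H) (τ : GamePath H S A B) :
    ∫ r, tailLoss h r ∂(G.rewardLaw τ) =
      ∑ k : Fin H with h ≤ k, (1 - G.meanReward k (τ k).1 (τ k).2.1 (τ k).2.2) := by
  have hprob : IsProbabilityMeasure (G.rewardLaw τ) := by unfold rewardLaw; infer_instance
  have hm : ∀ k, Measurable fun r : Fin H → I => (r k : ℝ) := fun k =>
    measurable_subtype_coe.comp (measurable_pi_apply k)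
  have hint : ∀ k, Integrable (fun r : Fin H → I => (r k : ℝ)) (G.rewardLaw τ) := fun k =>
    Integrable.of_bound (hm k).aestronglyMeasurable 1 (Filter.Eventually.of_forall fun r => by
      rw [Real.norm_of_nonneg (r k).2.1]; exact (r k).2.2)
  unfold tailLoss
  have hsub : ∀ k, Integrable (fun r : Fin H → I => 1 - (r k : ℝ)) (G.rewardLaw τ) := fun k =>
    (integrable_const 1).sub (hint k)
  rw [integral_finsetSum _ fun k _ => hsub k]
  refine Finset.sum_congr rfl fun k _ => ?_
  rw [integral_sub (integrable_const 1) (hint k), integral_const, probReal_univ, one_smul]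
  congr 1
  unfold rewardLaw POMG.meanReward
  exact integral_comp_eval (μ := fun k : Fin H =>
    (G.reward k (τ k).1 (τ k).2.1 (τ k).2.2 : Measure I)) (f := fun r : I => (r : ℝ))
    measurable_subtype_coe.aestronglyMeasurable

variable [∀ h, Fintype (X h)] [Fintype A]

theorem seqX_samplingPolicy (G : IIEFG H S X Y A B) (μ : Strategy H X A) (h : Fin H) (x : X h)
    (a : A) :
    G.seqX (G.samplingPolicy μ h) h h.2 x a = G.seqX (G.balanced h) h h.2 x a :=
  G.seqX_congr h h.2 (fun _ hj => if_pos hj) x a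

section

variable {Ω : Type*} {m : MeasurableSpace Ω} {P : Measure Ω} {ℱ : Filtration ℕ m} {T : ℕ} {η : ℝ}
  {ν : ℕ → Ω → Strategy H Y B} {path : ℕ → Fin H → Ω → GamePath H S A B}
  {rew : ℕ → Fin H → Ω → Fin H → I}

theorem IsBalancedCFRRun.measurable_visitLoss {G : IIEFG H S X Y A B}
    [Fintype B] (hrun : G.IsBalancedCFRRun P ℱ T η ν path rew) {t : ℕ} (ht : t < T) (h : Fin H) (x : X h)
    (a : A) : Measurable[ℱ (t * H + h + 1)]
      fun ω => G.visitLoss h x a (path t h ω) (rew t h ω) := by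
  classical
  have e : (fun ω => G.visitLoss h x a (path t h ω) (rew t h ω)) = fun ω =>
      (if G.infoX h (path t h ω h).1 = x ∧ (path t h ω h).2.1 = a then (1 : ℝ) else 0) *
        tailLoss h (rew t h ω) := by
    funext ω
    simp only [visitLoss, ite_mul, one_mul, zero_mul]
  rw [e]
  exact (@measurable_comp_of_fibers _ _ _ (ℱ (t * H + h + 1)) _ _ _ (hrun.path_meas t ht h)
    fun τ => if G.infoX h (τ h).1 = x ∧ (τ h).2.1 = a then (1 : ℝ) else 0).mul
    ((measurable_tailLoss h).comp (hrun.rew_meas t ht h))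

end

variable [Nonempty A]

theorem cfrPolicy_pos (G : IIEFG H S X Y A B) (η : ℝ) (obs : ℕ → Fin H → Observation H X A) (t : ℕ)
    (h : Fin H) (x : X h) (a : A) : 0 < G.cfrPolicy η obs t h x a := by
  induction t generalizing a with
  | zero => exact one_div_pos.2 (Nat.cast_pos.2 Fintype.card_pos)
  | succ t ih =>
    exact div_pos (mul_pos (ih a) (Real.exp_pos _))
      (Finset.sum_pos (fun a' _ => mul_pos (ih a') (Real.exp_pos _)) Finset.univ_nonempty)

theorem cfrPolicy_mem_policies (G : IIEFG H S X Y A B) (η : ℝ)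
    (obs : ℕ → Fin H → Observation H X A) (t : ℕ) : G.cfrPolicy η obs t ∈ policies H X A := by
  refine fun h x => ⟨fun a => (G.cfrPolicy_pos η obs t h x a).le, ?_⟩
  cases t with
  | zero => simp [cfrPolicy]
  | succ t =>
    simp only [cfrPolicy]
    rw [← Finset.sum_div]
    exact div_self (Finset.sum_pos (fun a' _ => mul_pos (G.cfrPolicy_pos η obs t h x a')
      (Real.exp_pos _)) Finset.univ_nonempty).ne'

/-- The potential argument of Hedge at one infoset. -/
theorem neg_log_card_sub_le (G : IIEFG H S X Y A B) (η : ℝ) (obs : ℕ → Fin H → Observation H X A)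
    (T : ℕ) (h : Fin H) (x : X h) (a : A) :
    -Real.log (Fintype.card A) - ∑ t ∈ Finset.range T,
        η * G.seqX (G.balanced h) h h.2 x a * G.lossEstimator h (obs t h) x a ≤
      ∑ t ∈ Finset.range T, Real.log (∑ a', G.cfrPolicy η obs t h x a' *
        Real.exp (-(η * G.seqX (G.balanced h) h h.2 x a' * G.lossEstimator h (obs t h) x a'))) := by
  -- The logarithm of the weight of `a` starts at -log A, and each update adds minus its exponent
  -- and minus the log-normalizer. As weights are at most 1, the final logarithm can be dropped.
  have hrec : ∀ n, -Real.log (Fintype.card A) - ∑ t ∈ Finset.range n,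
        η * G.seqX (G.balanced h) h h.2 x a * G.lossEstimator h (obs t h) x a =
      Real.log (G.cfrPolicy η obs n h x a) +
      ∑ t ∈ Finset.range n, Real.log (∑ a', G.cfrPolicy η obs t h x a' *
        Real.exp (-(η * G.seqX (G.balanced h) h h.2 x a' *
          G.lossEstimator h (obs t h) x a'))) := by
    intro n
    induction n with
    | zero => simp [cfrPolicy]
    | succ n ih =>
      rw [Finset.sum_range_succ, Finset.sum_range_succ, ← sub_sub, ih]
      simp only [cfrPolicy]
      rw [Real.log_div (mul_pos (G.cfrPolicy_pos η obs n h x a) (Real.exp_pos _)).ne'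
        (Finset.sum_pos (fun a' _ => mul_pos (G.cfrPolicy_pos η obs n h x a')
          (Real.exp_pos _)) Finset.univ_nonempty).ne',
        Real.log_mul (G.cfrPolicy_pos η obs n h x a).ne' (Real.exp_pos _).ne', Real.log_exp]
      ring
  rw [hrec T]
  have h1 : G.cfrPolicy η obs T h x a ≤ 1 := by
    rw [← (G.cfrPolicy_mem_policies η obs T h x).2]
    exact Finset.single_le_sum (fun a' _ => (G.cfrPolicy_pos η obs T h x a').le)
      (Finset.mem_univ a)
  linarith [Real.log_nonpos (G.cfrPolicy_pos η obs T h x a).le h1]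

theorem maintained_mem_policies (G : IIEFG H S X Y A B) {Ω : Type*} (η : ℝ)
    (path : ℕ → Fin H → Ω → GamePath H S A B) (rew : ℕ → Fin H → Ω → Fin H → I) (t : ℕ) (ω : Ω) :
    G.maintained η path rew t ω ∈ policies H X A :=
  G.cfrPolicy_mem_policies _ _ _

variable [Nonempty B]

theorem samplingPolicy_mem_policies (G : IIEFG H S X Y A B) {μ : Strategy H X A}
    (hμ : μ ∈ policies H X A) (h : Fin H) : G.samplingPolicy μ h ∈ policies H X A := by
  intro k x
  unfold samplingPolicy
  split_ifs
  exacts [G.balanced_mem_policies h k x, hμ k x]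

/-- The importance weight cancels, so what enters the Hedge exponent lies in [0, H] however small
the reach weight is. -/
theorem seqX_mul_lossEstimator (G : IIEFG H S X Y A B) (h : Fin H) (x : X h) (a : A)
    (τ : GamePath H S A B) (r : Fin H → I) :
    G.seqX (G.balanced h) h h.2 x a * G.lossEstimator h (G.observe τ r) x a =
      G.visitLoss h x a τ r := by
  have hp := (G.seqX_balanced_pos h h h.2 x a).ne'
  have e : (H : ℝ) - (h : ℝ) - ∑ k : Fin H with h ≤ k, ((G.observe τ r k).2.2 : ℝ) =
      tailLoss h r := (tailLoss_eq h r).symm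
  unfold lossEstimator visitLoss
  rw [e]
  by_cases hv : G.infoX h (τ h).1 = x ∧ (τ h).2.1 = a
  · rw [if_pos (show (G.observe τ r h).1 = x ∧ (G.observe τ r h).2.1 = a from hv), if_pos hv]
    field_simp
  · rw [if_neg (show ¬((G.observe τ r h).1 = x ∧ (G.observe τ r h).2.1 = a) from hv), if_neg hv]
    simp

variable {Ω : Type*} {m : MeasurableSpace Ω} {P : Measure Ω} {ℱ : Filtration ℕ m} {T : ℕ} {η : ℝ}
  {ν : ℕ → Ω → Strategy H Y B} {path : ℕ → Fin H → Ω → GamePath H S A B}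
  {rew : ℕ → Fin H → Ω → Fin H → I}

variable [Fintype B]

theorem IsBalancedCFRRun.measurable_maintained {G : IIEFG H S X Y A B}
    (hrun : G.IsBalancedCFRRun P ℱ T η ν path rew) {t : ℕ} (ht : t ≤ T) (h : Fin H) (x : X h)
    (a : A) : Measurable[ℱ (t * H)] fun ω => G.maintained η path rew t ω h x a := by
  induction t generalizing a with
  | zero => exact measurable_const
  | succ t ih =>
    -- The update at layer `h` uses episode (t, h) only, which is over before round t + 1 begins.
    have hle : t * H + h + 1 ≤ (t + 1) * H := by
      rw [Nat.succ_mul, add_assoc]; exact Nat.add_le_add_left h.2 _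
    have hw : ∀ a', Measurable[ℱ ((t + 1) * H)] fun ω => G.maintained η path rew t ω h x a' *
        Real.exp (-(η * G.seqX (G.balanced h) h h.2 x a' *
          G.lossEstimator h (G.observe (path t h ω) (rew t h ω)) x a')) := by
      intro a'
      simp only [mul_assoc η, seqX_mul_lossEstimator]
      exact ((ih (Nat.le_of_succ_le ht) a').mono
        (ℱ.mono (Nat.mul_le_mul_right _ t.le_succ)) le_rfl).mul (Real.measurable_exp.comp
          (((hrun.measurable_visitLoss ht h x a').mono (ℱ.mono hle) le_rfl).const_mul η).neg)
    exact (hw a).div (Finset.measurable_fun_sum _ fun a' _ => hw a')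

open Classical in
/-- Conditional expectation of a weighted count of visits of the infoset `x` in one episode. -/
theorem IsBalancedCFRRun.condExp_visit [IsProbabilityMeasure P] {G : IIEFG H S X Y A B}
    (hrun : G.IsBalancedCFRRun P ℱ T η ν path rew) {t : ℕ} (ht : t < T) (h : Fin H) (x : X h)
    {c : A → Ω → ℝ} (hc : ∀ a, Measurable[ℱ (t * H + h)] (c a)) (hc1 : ∀ a ω, |c a ω| ≤ 1)
    (α β : ℝ) :
    P[fun ω => ∑ a, c a ω * (if G.infoX h (path t h ω h).1 = x ∧ (path t h ω h).2.1 = a then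
        α * tailLoss h (rew t h ω) + β else 0) | ℱ (t * H + h)] =ᵐ[P]
      fun ω => ∑ a, c a ω * (G.seqX (G.balanced h) h h.2 x a *
        (α * G.contLoss (G.maintained η path rew t ω) (G.loss (ν t ω)) h x a +
          β * G.visitProb (ν t ω) h x)) := by
  let φ : (Fin H → I) → ℝ := fun r => α * tailLoss h r + β
  have hφ : Measurable φ := ((measurable_tailLoss h).const_mul α).add_const β
  have hφc : ∀ r, |φ r| ≤ |α| * H + |β| := fun r => by
    refine (abs_add_le _ _).trans (add_le_add_left ?_ _)
    rw [abs_mul, abs_of_nonneg (tailLoss_nonneg h r)]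
    exact mul_le_mul_of_nonneg_left (tailLoss_le h r) (abs_nonneg α)
  have hle := ℱ.le (t * H + h)
  let ψ : A → GamePath H S A B → Ω → ℝ := fun a τ ω =>
    if G.infoX h (τ h).1 = x ∧ (τ h).2.1 = a then c a ω else 0
  have hψ : ∀ a τ, Measurable[ℱ (t * H + h)] (ψ a τ) := fun a τ => by
    by_cases hv : G.infoX h (τ h).1 = x ∧ (τ h).2.1 = a
    · simp only [ψ, if_pos hv]; exact hc a
    · simp only [ψ, if_neg hv]; exact measurable_const
  have hψ1 : ∀ a τ ω, ‖ψ a τ ω‖ ≤ 1 := fun a τ ω => by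
    simp only [ψ]
    split_ifs
    · exact hc1 a ω
    · simp
  have hD : ∀ τ, MeasurableSet {ω | path t h ω = τ} := fun τ =>
    ℱ.le _ _ (hrun.path_meas t ht h τ)
  have hξ : Measurable (rew t h) := (hrun.rew_meas t ht h).mono (ℱ.le _) le_rfl
  -- Split by the realized path: for a fixed path, `ψ` is known before the episode and `g` is
  -- governed by the product law of path indicator and rewards.
  let g : GamePath H S A B → Ω → ℝ := fun τ =>
    Set.indicator {ω | path t h ω = τ} fun ω => φ (rew t h ω)
  have hg : ∀ τ, Integrable (g τ) P := fun τ => by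
    have h1 : Integrable (fun ω => φ (rew t h ω)) P :=
      Integrable.of_bound (hφ.comp hξ).aestronglyMeasurable (|α| * H + |β|)
        (Filter.Eventually.of_forall fun ω => hφc _)
    exact h1.indicator (hD τ)
  let p : GamePath H S A B → Ω → ℝ := fun τ ω =>
    G.pathProb (G.samplingPolicy (G.maintained η path rew t ω) h) (ν t ω) τ
  have hgc : ∀ τ, P[g τ | ℱ (t * H + h)] =ᵐ[P] fun ω => p τ ω * ∫ r, φ r ∂(G.rewardLaw τ) := by
    intro τ
    have hprob : IsProbabilityMeasure (G.rewardLaw τ) := by unfold rewardLaw; infer_instance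
    exact condExp_indicator_comp hle (hD τ) hξ
      (fun E hE => hrun.episode_law t ht h τ E hE) hφ hφc
  have hterm : ∀ a τ, P[ψ a τ * g τ | ℱ (t * H + h)] =ᵐ[P]
      fun ω => ψ a τ ω * (p τ ω * ∫ r, φ r ∂(G.rewardLaw τ)) := by
    intro a τ
    have h1 := condExp_stronglyMeasurable_mul_of_bound hle (hψ a τ).stronglyMeasurable (hg τ) 1
      (Filter.Eventually.of_forall (hψ1 a τ))
    filter_upwards [h1, hgc τ] with ω h2 h3
    rw [h2, Pi.mul_apply, h3]
  have hint : ∀ a τ, Integrable (ψ a τ * g τ) P := fun a τ =>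
    (hg τ).bdd_mul ((hψ a τ).mono hle le_rfl).aestronglyMeasurable
      (Filter.Eventually.of_forall (hψ1 a τ))
  have hsum : (fun ω => ∑ a, c a ω *
      (if G.infoX h (path t h ω h).1 = x ∧ (path t h ω h).2.1 = a then
        α * tailLoss h (rew t h ω) + β else 0)) =
      ∑ q : A × GamePath H S A B, ψ q.1 q.2 * g q.2 := by
    funext ω
    rw [Finset.sum_apply, Fintype.sum_prod_type]
    refine Finset.sum_congr rfl fun a _ => ?_
    rw [Finset.sum_eq_single (path t h ω)]
    · simp only [Pi.mul_apply, ψ, g, φ]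
      have hmem : ω ∈ {ω' | path t h ω' = path t h ω} := rfl
      rw [Set.indicator_of_mem hmem]
      split_ifs <;> simp
    · intro τ _ hτ
      simp only [Pi.mul_apply, g]
      have hmem : ω ∉ {ω' | path t h ω' = τ} := fun e => hτ (Eq.symm e)
      rw [Set.indicator_of_notMem hmem, mul_zero]
    · simp
  rw [hsum]
  have hcs := condExp_finsetSum (μ := P) (s := Finset.univ)
    (f := fun q : A × GamePath H S A B => ψ q.1 q.2 * g q.2) (fun q _ => hint q.1 q.2)
    (ℱ (t * H + h))
  have hall : ∀ᵐ ω ∂P, ∀ q : A × GamePath H S A B, (P[ψ q.1 q.2 * g q.2 | ℱ (t * H + h)]) ω =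
      ψ q.1 q.2 ω * (p q.2 ω * ∫ r, φ r ∂(G.rewardLaw q.2)) :=
    Filter.eventually_all.2 fun q => hterm q.1 q.2
  filter_upwards [hcs, hall] with ω h1 h2
  rw [h1, Finset.sum_apply, Finset.sum_congr rfl fun q _ => h2 q, Fintype.sum_prod_type]
  refine Finset.sum_congr rfl fun a _ => ?_
  set μ := G.maintained η path rew t ω with hμ
  have hμm : μ ∈ policies H X A := G.maintained_mem_policies η path rew t ω
  have hρ := G.samplingPolicy_mem_policies hμm h
  have hν := hrun.opponent_mem t ht ω
  have hφi : ∀ τ, ∫ r, φ r ∂(G.rewardLaw τ) =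
      α * ∑ k : Fin H with h ≤ k, (1 - G.meanReward k (τ k).1 (τ k).2.1 (τ k).2.2) + β := by
    intro τ
    have hprob : IsProbabilityMeasure (G.rewardLaw τ) := by unfold rewardLaw; infer_instance
    have hti : Integrable (tailLoss h) (G.rewardLaw τ) :=
      Integrable.of_bound (measurable_tailLoss h).aestronglyMeasurable H
        (Filter.Eventually.of_forall fun r => by
          rw [Real.norm_of_nonneg (tailLoss_nonneg h r)]; exact tailLoss_le h r)
    simp only [φ]
    rw [integral_add (hti.const_mul α) (integrable_const β), integral_const_mul,
      integral_tailLoss, integral_const, probReal_univ, one_smul]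
  -- The sampling policy agrees with the maintained one after layer `h`, so the episode sees exactly
  -- the counterfactual loss of the latter.
  have hcont : G.contLoss μ (G.loss (ν t ω)) h x a =
      G.contLoss (G.samplingPolicy μ h) (G.loss (ν t ω)) h x a :=
    G.contLoss_congr _ (fun j hj => (if_neg (not_le.2 hj)).symm) x a
  have hvis := G.sum_pathProb_visit hρ hν h x a
  have hvisk := fun k hk => G.sum_pathProb_visit_mul hρ hν h k hk x a
  rw [seqX_samplingPolicy] at hvis
  simp only [seqX_samplingPolicy] at hvisk
  have hL : ∑ k : Fin H with h ≤ k, ∑ τ, (if G.infoX h (τ h).1 = x ∧ (τ h).2.1 = a then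
        G.pathProb (G.samplingPolicy μ h) (ν t ω) τ else 0) *
        (1 - G.meanReward k (τ k).1 (τ k).2.1 (τ k).2.2) =
      G.seqX (G.balanced h) h h.2 x a * G.contLoss μ (G.loss (ν t ω)) h x a := by
    rw [hcont, contLoss, Finset.mul_sum]
    exact Finset.sum_congr rfl fun k hk => hvisk k (Finset.mem_filter.1 hk).2
  calc _ = ∑ τ, (c a ω * α * ((if G.infoX h (τ h).1 = x ∧ (τ h).2.1 = a then
        G.pathProb (G.samplingPolicy μ h) (ν t ω) τ else 0) *
        ∑ k : Fin H with h ≤ k, (1 - G.meanReward k (τ k).1 (τ k).2.1 (τ k).2.2)) +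
        c a ω * β * (if G.infoX h (τ h).1 = x ∧ (τ h).2.1 = a then
          G.pathProb (G.samplingPolicy μ h) (ν t ω) τ else 0)) := by
        refine Finset.sum_congr rfl fun τ _ => ?_
        rw [hφi]
        simp only [ψ, p]
        split_ifs <;> ring
    _ = _ := by
        rw [Finset.sum_add_distrib, ← Finset.mul_sum, ← Finset.mul_sum, hvis]
        simp only [Finset.mul_sum (s := Finset.filter _ _)]
        rw [Finset.sum_comm, hL]
        ring

end IIEFG

/-! ### Local regret bounds and their summation -/

namespace IIEFG

variable {H : ℕ} {S X Y : ℕ → Type*} {A B : Type*} [∀ h, Fintype (S h)]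

theorem exp_le_one_add_add_sq {u : ℝ} (hu : |u| ≤ 1) : Real.exp u ≤ 1 + u + u ^ 2 := by
  linarith [(abs_le.1 (Real.abs_exp_sub_one_sub_id_le hu)).2]

-- Off the visit both sides are 1; on it, apply e^u ≤ 1 + u + u². The sign of `θ` is free because
-- the bound serves both the Hedge normalizer and the loss of the comparison action.
open Classical in
theorem exp_mul_visitLoss_le (G : IIEFG H S X Y A B) {θ : ℝ} (hθ : |θ| * H ≤ 1) (h : Fin H)
    (x : X h) (a : A) (τ : GamePath H S A B) (r : Fin H → I) :
    Real.exp (θ * G.visitLoss h x a τ r) ≤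
      1 + if G.infoX h (τ h).1 = x ∧ (τ h).2.1 = a then
        θ * tailLoss h r + θ ^ 2 * (H : ℝ) ^ 2 else 0 := by
  unfold visitLoss
  split_ifs
  · have h1 : |θ * tailLoss h r| ≤ 1 := by
      rw [abs_mul, abs_of_nonneg (tailLoss_nonneg h r)]
      exact (mul_le_mul_of_nonneg_left (tailLoss_le h r) (abs_nonneg θ)).trans hθ
    have h2 : (θ * tailLoss h r) ^ 2 ≤ θ ^ 2 * (H : ℝ) ^ 2 := by
      rw [mul_pow]
      exact mul_le_mul_of_nonneg_left (pow_le_pow_left₀ (tailLoss_nonneg h r) (tailLoss_le h r) 2)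
        (sq_nonneg θ)
    linarith [exp_le_one_add_add_sq h1]
  · simp

variable [∀ h, Fintype (X h)] [Fintype A]

section

variable [Fintype B]

/-- The regret of `μ` against the action `a` at the infoset `x` alone. -/
def localRegret (G : IIEFG H S X Y A B) (μ : Strategy H X A) (ν : Strategy H Y B) (h : Fin H)
    (x : X h) (a : A) : ℝ :=
  (∑ a', μ h x a' * G.contLoss μ (G.loss ν) h x a') - G.contLoss μ (G.loss ν) h x a

/-- As the comparator's actions have total mass 1 at `x`, the loss of `μ` can be moved inside the
average over `a`. This leaves nonnegative weights on regrets against fixed actions. -/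
theorem pairing_sub_pairing_eq_localRegret (G : IIEFG H S X Y A B) (μ : Strategy H X A)
    {μ' : Strategy H X A} (hμ' : μ' ∈ policies H X A) (ν : Strategy H Y B) :
    G.pairing μ (G.loss ν) - G.pairing μ' (G.loss ν) =
      ∑ h : Fin H, ∑ x : X h, ∑ a, G.seqX μ' h h.2 x a * G.localRegret μ ν h x a := by
  rw [pairing_sub_pairing]
  refine Finset.sum_congr rfl fun h _ => Finset.sum_congr rfl fun x _ => ?_
  simp only [seqX_eq, localRegret, mul_assoc]
  rw [← Finset.mul_sum]
  congr 1
  simp only [sub_mul, mul_sub, Fin.eta]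
  rw [Finset.sum_sub_distrib, Finset.sum_sub_distrib, ← Finset.sum_mul, (hμ' h x).2, one_mul]

end

variable [Nonempty A] [Nonempty B] {Ω : Type*} {m : MeasurableSpace Ω} {P : Measure Ω}
  {ℱ : Filtration ℕ m} {T : ℕ} {η : ℝ} {ν : ℕ → Ω → Strategy H Y B}
  {path : ℕ → Fin H → Ω → GamePath H S A B} {rew : ℕ → Fin H → Ω → Fin H → I}

/-- The normalization of the Hedge update at `x` after round `t`. -/
def hedgeSum (G : IIEFG H S X Y A B) (η : ℝ) (path : ℕ → Fin H → Ω → GamePath H S A B)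
    (rew : ℕ → Fin H → Ω → Fin H → I) (h : Fin H) (x : X h) (t : ℕ) (ω : Ω) : ℝ :=
  ∑ a, G.maintained η path rew t ω h x a *
    Real.exp (-(η * G.visitLoss h x a (path t h ω) (rew t h ω)))

theorem neg_log_card_sub_le_hedgeSum (G : IIEFG H S X Y A B) (T : ℕ) (h : Fin H) (x : X h) (a : A)
    (ω : Ω) :
    -Real.log (Fintype.card A) - ∑ t ∈ Finset.range T,
        η * G.visitLoss h x a (path t h ω) (rew t h ω) ≤
      ∑ t ∈ Finset.range T, Real.log (G.hedgeSum η path rew h x t ω) := by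
  have key := G.neg_log_card_sub_le η (fun t h => G.observe (path t h ω) (rew t h ω)) T h x a
  simp only [mul_assoc η, seqX_mul_lossEstimator] at key
  exact key

variable [Fintype B]

open Classical in
/-- Deviation inequality for increments whose exponential moments are controlled by weighted counts
of the visits of the infoset `x`. -/
theorem IsBalancedCFRRun.measure_le_sum_sub_le [IsProbabilityMeasure P] {G : IIEFG H S X Y A B}
    (hrun : G.IsBalancedCFRRun P ℱ T η ν path rew) (h : Fin H) (x : X h) {c : ℕ → A → Ω → ℝ}
    (hc : ∀ t < T, ∀ a, Measurable[ℱ (t * H + h)] (c t a)) (hc1 : ∀ t a ω, |c t a ω| ≤ 1)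
    (α β : ℝ) {W : ℕ → Ω → ℝ} (hW : ∀ t < T, Measurable[ℱ (t * H + h + 1)] (W t))
    (hWK : ∀ t < T, ∀ ω, Real.exp (W t ω) ≤ 1 + ∑ a, c t a ω *
      (if G.infoX h (path t h ω h).1 = x ∧ (path t h ω h).2.1 = a then
        α * tailLoss h (rew t h ω) + β else 0)) (ε : ℝ) :
    P {ω | ε ≤ ∑ t ∈ Finset.range T, (W t ω - ∑ a, c t a ω * (G.seqX (G.balanced h) h h.2 x a *
        (α * G.contLoss (G.maintained η path rew t ω) (G.loss (ν t ω)) h x a +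
          β * G.visitProb (ν t ω) h x)))} ≤ ENNReal.ofReal (Real.exp (-ε)) := by
  -- For fixed `h` time runs through the rounds, each sampled just before its episode `h`.
  have hmono : Monotone fun t => (ℱ (t * H + h) : MeasurableSpace Ω) := fun s t hst =>
    ℱ.mono (Nat.add_le_add_right (Nat.mul_le_mul_right _ hst) _)
  have hstep : ∀ t, t * H + h + 1 ≤ (t + 1) * H + h := fun t => by
    have := h.pos
    rw [Nat.succ_mul]
    omega
  refine _root_.measure_le_sum_sub_le (𝒢 := fun t => ℱ (t * H + h)) hmono (fun t => ℱ.le _)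
    (c := ∑ _ : A, (|α| * H + |β|))
    (fun t ht => (hW t ht).mono (ℱ.mono (hstep t)) le_rfl) ?_ hWK ?_
    (fun t ht => hrun.condExp_visit ht h x (hc t ht) (hc1 t) α β) ε
  · intro t ht
    refine Finset.measurable_fun_sum _ fun a _ => ((hc t ht a).mono (ℱ.le _) le_rfl).mul ?_
    have e : (fun ω => if G.infoX h (path t h ω h).1 = x ∧ (path t h ω h).2.1 = a then
        α * tailLoss h (rew t h ω) + β else 0) = fun ω =>
        (if G.infoX h (path t h ω h).1 = x ∧ (path t h ω h).2.1 = a then (1 : ℝ) else 0) *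
          (α * tailLoss h (rew t h ω) + β) := by
      funext ω
      simp only [ite_mul, one_mul, zero_mul]
    rw [e]
    exact (measurable_comp_of_fibers (fun τ => ℱ.le _ _ (hrun.path_meas t ht h τ))
      fun τ => if G.infoX h (τ h).1 = x ∧ (τ h).2.1 = a then (1 : ℝ) else 0).mul
      ((((measurable_tailLoss h).comp ((hrun.rew_meas t ht h).mono (ℱ.le _) le_rfl)).const_mul
        α).add_const β)
  · intro t _ ω
    refine (Finset.abs_sum_le_sum_abs _ _).trans (Finset.sum_le_sum fun a _ => ?_)
    rw [abs_mul]
    refine (mul_le_of_le_one_left (abs_nonneg _) (hc1 t a ω)).trans ?_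
    split_ifs
    · refine (abs_add_le _ _).trans (add_le_add_left ?_ _)
      rw [abs_mul, abs_of_nonneg (tailLoss_nonneg h _)]
      exact mul_le_mul_of_nonneg_left (tailLoss_le h _) (abs_nonneg α)
    · rw [abs_zero]
      positivity

/-- With high probability, the local regret at `(x, a)` is small. -/
theorem IsBalancedCFRRun.measure_localRegret [IsProbabilityMeasure P] {G : IIEFG H S X Y A B}
    (hrun : G.IsBalancedCFRRun P ℱ T η ν path rew) (hη : 0 < η) (hηH : η * H ≤ 1) (h : Fin H)
    (x : X h) (a : A) (ε : ℝ) :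
    P {ω | ¬ ∑ t ∈ Finset.range T, G.localRegret (G.maintained η path rew t ω) (ν t ω) h x a ≤
        (Real.log (Fintype.card A) + 2 * ε) / η / G.seqX (G.balanced h) h h.2 x a +
          2 * η * (H : ℝ) ^ 2 * ∑ t ∈ Finset.range T, G.visitProb (ν t ω) h x} ≤
      ENNReal.ofReal (2 * Real.exp (-ε)) := by
  classical
  set b : ℝ := G.seqX (G.balanced h) h h.2 x a with hb
  have hb0 : 0 < b := G.seqX_balanced_pos h h h.2 x a
  -- Because the reach weight is the same for all actions, the compensators combine into the local
  -- regret times one common factor.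
  have hba : ∀ a', G.seqX (G.balanced h) h h.2 x a' = b := fun a' => by
    rw [hb, seqX_balanced_self, seqX_balanced_self]
  have hmaint : ∀ t < T, ∀ a', Measurable[ℱ (t * H + h)]
      fun ω => G.maintained η path rew t ω h x a' := fun t ht a' =>
    (hrun.measurable_maintained ht.le h x a').mono (ℱ.mono (Nat.le_add_right _ _)) le_rfl
  have hmaint1 : ∀ t a' ω, |G.maintained η path rew t ω h x a'| ≤ 1 := fun t a' ω => by
    have hm := G.maintained_mem_policies η path rew t ω h x
    rw [abs_of_nonneg (hm.1 a'), ← hm.2]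
    exact Finset.single_le_sum (fun a'' _ => hm.1 a'') (Finset.mem_univ a')
  have hvl : ∀ t < T, ∀ a', Measurable[ℱ (t * H + h + 1)]
      fun ω => G.visitLoss h x a' (path t h ω) (rew t h ω) := fun t ht a' =>
    hrun.measurable_visitLoss ht h x a'
  have hQpos : ∀ t ω, 0 < G.hedgeSum η path rew h x t ω := fun t ω =>
    Finset.sum_pos (fun a' _ => mul_pos (G.cfrPolicy_pos _ _ _ _ _ _) (Real.exp_pos _))
      Finset.univ_nonempty
  -- Upper bound for the log-normalizers, with the current policy as weights and exponent parameter
  -- `-η`.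
  have h1 := hrun.measure_le_sum_sub_le h x
    (c := fun t a' ω => G.maintained η path rew t ω h x a') hmaint hmaint1 (-η)
    ((-η) ^ 2 * (H : ℝ) ^ 2) (W := fun t ω => Real.log (G.hedgeSum η path rew h x t ω))
    (fun t ht => Real.measurable_log.comp (Finset.measurable_fun_sum _ fun a' _ =>
      ((hmaint t ht a').mono (ℱ.mono (Nat.le_succ _)) le_rfl).mul
        (Real.measurable_exp.comp ((hvl t ht a').const_mul η).neg)))
    (fun t ht ω => by
      have hm := G.maintained_mem_policies η path rew t ω h x
      rw [Real.exp_log (hQpos t ω), ← hm.2, ← Finset.sum_add_distrib]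
      refine Finset.sum_le_sum fun a' _ => ?_
      rw [← mul_one_add, ← neg_mul]
      exact mul_le_mul_of_nonneg_left (G.exp_mul_visitLoss_le
        (by rwa [abs_neg, abs_of_pos hη]) h x a' _ _) (hm.1 a')) ε
  -- Upper bound for the observed losses of `a`, with the point mass at `a` as weights and exponent
  -- parameter `η`.
  have h2 := hrun.measure_le_sum_sub_le h x
    (c := fun _ a' _ => if a' = a then 1 else 0) (fun t ht a' => measurable_const)
    (fun t a' ω => by split_ifs <;> simp) η (η ^ 2 * (H : ℝ) ^ 2)
    (W := fun t ω => η * G.visitLoss h x a (path t h ω) (rew t h ω))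
    (fun t ht => (hvl t ht a).const_mul η)
    (fun t ht ω => by
      simp only [ite_mul, one_mul, zero_mul, Finset.sum_ite_eq', Finset.mem_univ, if_true]
      exact G.exp_mul_visitLoss_le (by rwa [abs_of_pos hη]) h x a _ _) ε
  have h12 := (measure_union_le _ _).trans (add_le_add h1 h2)
  rw [← ENNReal.ofReal_add (Real.exp_pos _).le (Real.exp_pos _).le, ← two_mul] at h12
  refine (measure_mono fun ω hω => ?_).trans h12
  by_contra hno
  rw [Set.mem_union, not_or] at hno
  obtain ⟨hn1, hn2⟩ := hno
  refine hω ?_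
  simp only [Set.mem_ofPred_eq, not_le] at hn1 hn2
  have hn1' := hn1.le
  have hn2' := hn2.le
  have hhedge := G.neg_log_card_sub_le_hedgeSum (η := η) (path := path) (rew := rew) T h x a ω
  simp only [ite_mul, one_mul, zero_mul, Finset.sum_ite_eq', Finset.mem_univ, if_true, hba]
    at hn1' hn2'
  rw [Finset.sum_sub_distrib] at hn1' hn2'
  -- The linear parts of the two compensators form minus the local regret; each quadratic part
  -- contributes one of the two copies of η²H² times the visit probability.
  have hsum : ∑ t ∈ Finset.range T, ∑ a', G.maintained η path rew t ω h x a' *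
        (b * (-η * G.contLoss (G.maintained η path rew t ω) (G.loss (ν t ω)) h x a' +
          (-η) ^ 2 * (H : ℝ) ^ 2 * G.visitProb (ν t ω) h x)) +
      ∑ t ∈ Finset.range T,
        b * (η * G.contLoss (G.maintained η path rew t ω) (G.loss (ν t ω)) h x a +
          η ^ 2 * (H : ℝ) ^ 2 * G.visitProb (ν t ω) h x) =
      -(η * b) * ∑ t ∈ Finset.range T,
        G.localRegret (G.maintained η path rew t ω) (ν t ω) h x a +
      η * b * (2 * η * (H : ℝ) ^ 2 * ∑ t ∈ Finset.range T, G.visitProb (ν t ω) h x) := by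
    simp only [Finset.mul_sum]
    rw [← Finset.sum_add_distrib, ← Finset.sum_add_distrib]
    refine Finset.sum_congr rfl fun t _ => ?_
    have hm := G.maintained_mem_policies η path rew t ω h x
    have e : ∑ a', G.maintained η path rew t ω h x a' *
        (b * (-η * G.contLoss (G.maintained η path rew t ω) (G.loss (ν t ω)) h x a' +
          (-η) ^ 2 * (H : ℝ) ^ 2 * G.visitProb (ν t ω) h x)) =
        -(η * b) * (∑ a', G.maintained η path rew t ω h x a' *
          G.contLoss (G.maintained η path rew t ω) (G.loss (ν t ω)) h x a') +
        b * (η ^ 2 * (H : ℝ) ^ 2 * G.visitProb (ν t ω) h x) := by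
      rw [← mul_one (b * (η ^ 2 * (H : ℝ) ^ 2 * G.visitProb (ν t ω) h x)), ← hm.2,
        Finset.mul_sum, Finset.mul_sum, ← Finset.sum_add_distrib]
      exact Finset.sum_congr rfl fun a' _ => by ring
    rw [e, localRegret]
    ring
  have hηb : 0 < η * b := mul_pos hη hb0
  rw [div_div, ← sub_le_iff_le_add, le_div_iff₀ hηb]
  linarith

/-- The regret bound for small learning rates, on the event that all local regrets are small. -/
theorem sum_pairing_sub_le {G : IIEFG H S X Y A B} {μ : ℕ → Strategy H X A}
    {ν : ℕ → Strategy H Y B} (hν : ∀ t < T, ν t ∈ policies H Y B) {κ : ℝ}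
    (hloc : ∀ (h : Fin H) (x : X h) (a : A), ∑ t ∈ Finset.range T, G.localRegret (μ t) (ν t) h x a ≤
      κ / G.seqX (G.balanced h) h h.2 x a +
        2 * η * (H : ℝ) ^ 2 * ∑ t ∈ Finset.range T, G.visitProb (ν t) h x)
    {μ' : Strategy H X A} (hμ' : μ' ∈ policies H X A) :
    ∑ t ∈ Finset.range T, (G.pairing (μ t) (G.loss (ν t)) - G.pairing μ' (G.loss (ν t))) ≤
      κ * (numInfosets H X * Fintype.card A) + 2 * η * (H : ℝ) ^ 3 * T := by
  simp only [G.pairing_sub_pairing_eq_localRegret _ hμ']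
  rw [Finset.sum_comm]
  have hh : ∀ h : Fin H, ∑ t ∈ Finset.range T, ∑ x : X h, ∑ a,
      G.seqX μ' h h.2 x a * G.localRegret (μ t) (ν t) h x a ≤
        κ * (Fintype.card (X h) * Fintype.card A) + 2 * η * (H : ℝ) ^ 2 * T := by
    intro h
    -- The visit probabilities do not depend on the action, so summing it out leaves total mass 1
    -- per round.
    have hvis : ∑ x : X h, ∑ a, G.seqX μ' h h.2 x a * ∑ t ∈ Finset.range T, G.visitProb (ν t) h x =
        T := by
      have e : ∀ x : X h, ∑ a, G.seqX μ' h h.2 x a *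
          ∑ t ∈ Finset.range T, G.visitProb (ν t) h x =
          ∑ t ∈ Finset.range T, G.priorX μ' h h.2 x * G.visitProb (ν t) h x := by
        intro x
        simp only [seqX_eq]
        rw [← Finset.sum_mul, ← Finset.mul_sum, (hμ' h x).2, mul_one, Finset.mul_sum]
      simp only [e]
      rw [Finset.sum_comm, Finset.sum_congr rfl fun t ht =>
        G.sum_priorX_mul_visitProb hμ' (hν t (Finset.mem_range.1 ht)) h]
      simp
    calc _ = ∑ x : X h, ∑ a, G.seqX μ' h h.2 x a *
          ∑ t ∈ Finset.range T, G.localRegret (μ t) (ν t) h x a := by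
          rw [Finset.sum_comm]
          refine Finset.sum_congr rfl fun x _ => ?_
          rw [Finset.sum_comm]
          exact Finset.sum_congr rfl fun a _ => (Finset.mul_sum _ _ _).symm
      _ ≤ ∑ x : X h, ∑ a, G.seqX μ' h h.2 x a * (κ / G.seqX (G.balanced h) h h.2 x a +
            2 * η * (H : ℝ) ^ 2 * ∑ t ∈ Finset.range T, G.visitProb (ν t) h x) :=
          Finset.sum_le_sum fun x _ => Finset.sum_le_sum fun a _ =>
            mul_le_mul_of_nonneg_left (hloc h x a)
              (G.seqX_nonneg (fun h x a => (hμ' h x).1 a) _ _ _ _)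
      _ = κ * (∑ x : X h, ∑ a, G.seqX μ' h h.2 x a / G.seqX (G.balanced h) h h.2 x a) +
            2 * η * (H : ℝ) ^ 2 * ∑ x : X h, ∑ a, G.seqX μ' h h.2 x a *
              ∑ t ∈ Finset.range T, G.visitProb (ν t) h x := by
          rw [Finset.mul_sum, Finset.mul_sum, ← Finset.sum_add_distrib]
          refine Finset.sum_congr rfl fun x _ => ?_
          generalize ∑ t ∈ Finset.range T, G.visitProb (ν t) h x = v
          rw [Finset.mul_sum, Finset.mul_sum, ← Finset.sum_add_distrib]
          exact Finset.sum_congr rfl fun a _ => by ring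
      _ = _ := by rw [G.sum_seqX_div_balanced hμ' h, hvis]
  refine (Finset.sum_le_sum fun h _ => hh h).trans (le_of_eq ?_)
  rw [Finset.sum_add_distrib, ← Finset.mul_sum, ← Finset.sum_mul, Finset.sum_const,
    Finset.card_univ, Fintype.card_fin, nsmul_eq_mul, numInfosets, Nat.cast_sum]
  ring

end IIEFG

end

/-! ### The regret bound -/

theorem theorem4 :
    ∃ C : ℝ, 0 < C ∧
      ∀ (H : ℕ) (S X Y : ℕ → Type*) (A B : Type*)
        [∀ h, Fintype (S h)] [∀ h, Fintype (X h)] [∀ h, Fintype (Y h)]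
        [Fintype A] [Nonempty A] [Fintype B] [Nonempty B]
        (G : IIEFG H S X Y A B) (T : ℕ) (_ : 1 ≤ T) (δ : ℝ) (_ : 0 < δ) (_ : δ < 1)
        (x ι η : ℝ) (_ : x = IIEFG.numInfosets H X)
        (_ : ι = Real.log (10 * x * Fintype.card A / δ))
        (_ : η = Real.sqrt (x * Fintype.card A * ι / ((H : ℝ) ^ 3 * T)))
        (Ω : Type*) [m : MeasurableSpace Ω] (P : Measure Ω) [IsProbabilityMeasure P]
        (ℱ : Filtration ℕ m) (ν : ℕ → Ω → Strategy H Y B)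
        (path : ℕ → Fin H → Ω → GamePath H S A B) (rew : ℕ → Fin H → Ω → Fin H → unitInterval),
        G.IsBalancedCFRRun P ℱ T η ν path rew →
          ENNReal.ofReal (1 - δ) ≤
            P {ω | ∀ μ' ∈ policies H X A,
              ∑ t ∈ Finset.range T,
                  (G.pairing (G.maintained η path rew t ω) (G.loss (ν t ω)) -
                    G.pairing μ' (G.loss (ν t ω))) ≤
                C * Real.sqrt ((H : ℝ) ^ 3 * x * Fintype.card A * T * ι)} := by
  -- 5 = 3 + 2: the first term carries log A + 2ι ≤ 3ι, the second-order term a factor 2.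
  refine ⟨5, by norm_num, ?_⟩
  intro H S X Y A B _ _ _ _ _ _ _ G T hT δ hδ0 hδ1 x ι η hx hι hη Ω m P _ ℱ ν path rew hrun
  have hH : (0 : ℝ) < H := Nat.cast_pos.2 G.H_pos
  have hTpos : (0 : ℝ) < T := Nat.cast_pos.2 hT
  have hA1 : (1 : ℝ) ≤ Fintype.card A := Nat.one_le_cast.2 Fintype.card_pos
  -- The initial distribution forces a state, hence an infoset, in layer 0; this makes `ι` and `η`
  -- positive.
  have hx1 : 1 ≤ x := by
    have hne : Nonempty (S 0) := by
      by_contra hemp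
      rw [not_nonempty_iff] at hemp
      have := G.init_mem.2
      simp at this
    have : 0 < IIEFG.numInfosets H X :=
      Finset.sum_pos' (fun _ _ => Nat.zero_le _) ⟨⟨0, G.H_pos⟩, Finset.mem_univ _,
        Fintype.card_pos_iff.2 (hne.map (G.infoX 0))⟩
    rw [hx]
    exact_mod_cast this
  set Ac : ℝ := (Fintype.card A : ℝ) with hAc
  have hxA : 0 < x * Ac := by positivity
  have harg : Ac ≤ 10 * x * Ac / δ := by
    rw [le_div_iff₀ hδ0]
    nlinarith
  have hιlog : Real.log Ac ≤ ι := by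
    rw [hι]
    exact Real.log_le_log (by positivity) harg
  have hι0 : 0 < ι := by
    rw [hι]
    refine Real.log_pos ?_
    rw [lt_div_iff₀ hδ0]
    nlinarith
  have hexp : Real.exp (-ι) = δ / (10 * x * Ac) := by
    rw [hι, Real.exp_neg, Real.exp_log (by positivity), inv_div]
  set Rt : ℝ := Real.sqrt ((H : ℝ) ^ 3 * x * Ac * T * ι) with hRt
  have hRt0 : 0 ≤ Rt := Real.sqrt_nonneg _
  have hRt2 : Rt ^ 2 = (H : ℝ) ^ 3 * x * Ac * T * ι := Real.sq_sqrt (by positivity)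
  have hη0 : 0 < η := by rw [hη]; positivity
  have hη2 : η ^ 2 = x * Ac * ι / ((H : ℝ) ^ 3 * T) := by rw [hη]; exact Real.sq_sqrt (by positivity)
  have hηR : η * ((H : ℝ) ^ 3 * T) = Rt := by
    rw [← sq_eq_sq₀ (by positivity) hRt0, hRt2, mul_pow, hη2]
    field_simp
  have hηR' : ι / η * (x * Ac) = Rt := by
    rw [div_mul_eq_mul_div, div_eq_iff hη0.ne', ← hηR]
    calc ι * (x * Ac) = η ^ 2 * ((H : ℝ) ^ 3 * T) := by rw [hη2]; field_simp
      _ = _ := by ring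
  -- Since η²H² = XAι/(HT), the first case is exactly η H ≤ 1, the condition for the quadratic bound
  -- on the exponential.
  rcases le_or_gt (x * Ac * ι) (H * T) with hsmall | hlarge
  · have hηH : η * H ≤ 1 := by
      rw [← sq_le_one_iff₀ (by positivity), mul_pow, hη2, div_mul_eq_mul_div,
        div_le_one (by positivity)]
      calc x * Ac * ι * (H : ℝ) ^ 2 ≤ H * T * (H : ℝ) ^ 2 :=
            mul_le_mul_of_nonneg_right hsmall (by positivity)
        _ = _ := by ring
    let bad : (Σ h : Fin H, X h × A) → Set Ω := fun q =>
      {ω | ¬ ∑ t ∈ Finset.range T,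
          G.localRegret (G.maintained η path rew t ω) (ν t ω) q.1 q.2.1 q.2.2 ≤
        (Real.log Ac + 2 * ι) / η / G.seqX (G.balanced q.1) q.1 q.1.2 q.2.1 q.2.2 +
          2 * η * (H : ℝ) ^ 2 * ∑ t ∈ Finset.range T, G.visitProb (ν t ω) q.1 q.2.1}
    have hbad : P (⋃ q, bad q) ≤ ENNReal.ofReal δ := by
      refine (measure_iUnion_fintype_le P bad).trans ((Finset.sum_le_sum fun q _ =>
        hrun.measure_localRegret hη0 hηH q.1 q.2.1 q.2.2 ι).trans ?_)
      rw [Finset.sum_const, Finset.card_univ, nsmul_eq_mul, Fintype.card_sigma,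
        ← ENNReal.ofReal_natCast, ← ENNReal.ofReal_mul (Nat.cast_nonneg _)]
      refine ENNReal.ofReal_le_ofReal ?_
      have hcard : ((∑ h : Fin H, Fintype.card (X h × A) : ℕ) : ℝ) = x * Ac := by
        simp only [Fintype.card_prod]
        rw [← Finset.sum_mul, hx, Nat.cast_mul]
        rfl
      rw [hcard, hexp]
      -- XA pairs with failure probability 2e^(-ι) each: the 10 inside `ι` leaves room to spare.
      have : x * Ac * (2 * (δ / (10 * x * Ac))) = δ / 5 := by field_simp; norm_num
      rw [this]
      linarith
    -- Covering the whole space needs only subadditivity, so measurability of the good event, an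
    -- intersection over uncountably many comparators, never matters.
    have hcover : (Set.univ : Set Ω) ⊆ {ω | ∀ μ' ∈ policies H X A, ∑ t ∈ Finset.range T,
        (G.pairing (G.maintained η path rew t ω) (G.loss (ν t ω)) -
          G.pairing μ' (G.loss (ν t ω))) ≤ 5 * Rt} ∪ ⋃ q, bad q := by
      intro ω _
      by_cases hω : ω ∈ ⋃ q, bad q
      · exact Or.inr hω
      refine Or.inl fun μ' hμ' => ?_
      have hgood : ∀ q, ω ∉ bad q := fun q hq => hω (Set.mem_iUnion.2 ⟨q, hq⟩)
      refine (IIEFG.sum_pairing_sub_le (η := η) (fun t ht => hrun.opponent_mem t ht ω)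
        (fun h x a => not_not.1 (hgood ⟨h, x, a⟩)) hμ').trans ?_
      rw [← hx]
      calc (Real.log Ac + 2 * ι) / η * (x * Ac) + 2 * η * (H : ℝ) ^ 3 * T
          ≤ 3 * ι / η * (x * Ac) + 2 * η * (H : ℝ) ^ 3 * T := by
            refine add_le_add_left (mul_le_mul_of_nonneg_right
              (div_le_div_of_nonneg_right ?_ hη0.le) hxA.le) _
            linarith
        _ = 3 * (ι / η * (x * Ac)) + 2 * (η * ((H : ℝ) ^ 3 * T)) := by ring
        _ = 5 * Rt := by rw [hηR, hηR']; ring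
    rw [ENNReal.ofReal_sub _ hδ0.le, ENNReal.ofReal_one]
    refine tsub_le_iff_right.2 (measure_univ.symm.le.trans ((measure_mono hcover).trans
      ((measure_union_le _ _).trans (add_le_add_right hbad _))))
  · have hall : {ω | ∀ μ' ∈ policies H X A, ∑ t ∈ Finset.range T,
        (G.pairing (G.maintained η path rew t ω) (G.loss (ν t ω)) -
          G.pairing μ' (G.loss (ν t ω))) ≤ 5 * Rt} = Set.univ := by
      refine Set.eq_univ_of_forall fun ω μ' hμ' => ?_
      -- Here XAι > HT, so the target already exceeds the largest conceivable regret.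
      have hHT : (H : ℝ) * T ≤ Rt := by
        rw [← sq_le_sq₀ (by positivity) hRt0, hRt2]
        have h1 : (1 : ℝ) ≤ (H : ℝ) ^ 2 := one_le_pow₀ (Nat.one_le_cast.2 G.H_pos)
        calc ((H : ℝ) * T) ^ 2 = H * T * (H * T) := sq _
          _ ≤ H * T * (x * Ac * ι) := mul_le_mul_of_nonneg_left hlarge.le (by positivity)
          _ ≤ (H : ℝ) ^ 2 * (H * T * (x * Ac * ι)) :=
            le_mul_of_one_le_left (by positivity) h1
          _ = _ := by ring
      calc _ ≤ ∑ t ∈ Finset.range T, (H : ℝ) := Finset.sum_le_sum fun t ht => by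
            have hν := hrun.opponent_mem t (Finset.mem_range.1 ht) ω
            linarith [G.pairing_loss_nonneg hμ' hν,
              G.pairing_loss_le (G.maintained_mem_policies η path rew t ω) hν]
        _ = H * T := by rw [Finset.sum_const, Finset.card_range, nsmul_eq_mul, mul_comm]
        _ ≤ 5 * Rt := by linarith
    rw [hall, measure_univ]
    exact ENNReal.ofReal_le_one.2 (by linarith)
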